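/- Let $L$ be a finite-dimensional complex solvable Lie algebra acting from the right on a complex Banach space $E$ by bounded operators, i.e. through a Lie algebra homomorphism from $L$ to the algebra $\mathcal L(E)^{\mathrm{op}}$ of bounded operators with the opposite product (for instance, $L$ a Lie subalgebra of $\mathcal L(E)^{\mathrm{op}}$). For $f\in L^*$ with $f([L,L])=0$ let $H_*(L,E\otimes\mathbb C(f))$ be the homology of the complex $(E\otimes\wedge^p L)_{p\ge 0}$ with boundary $$ d(e\otimes x_1\wedge\cdots\wedge x_p)=\sum_{k=1}^p(-1)^{k+1}\bigl(e\cdot x_k-f(x_k)e\bigr)\otimes x_1\wedge\cdots\widehat{x_k}\cdots\wedge x_p+\sum_{1\le k<l\le p}(-1)^{k+l}\,e\otimes[x_k,x_l]\wedge x_1\wedge\cdots\widehat{x_k}\cdots\widehat{x_l}\cdots\wedge x_p , $$ and let $$ Sp(L,E)=\{f\in L^*:\ f([L,L])=0,\ H_*(L,E\otimes\mathbb C(f))\neq 0\}. $$ Let $I$ be an ideal of $L$, acting on $E$ by restriction, and let $\pi:L^*\to I^*$, $\pi(f)=f|_I$, be the restriction map. Then $$ Sp(I,E)=\pi(Sp(L,E)).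 $$ -/

import Mathlib

open scoped TensorProduct
open ExteriorAlgebra

-- The commutator bracket `⁅a, b⁆ = a * b - b * a` on an associative ring.
attribute [local instance 100] LieRing.ofAssociativeRing

namespace LieKoszul

section Algebra

variable {k L M : Type*} [CommRing k] [LieRing L] [LieAlgebra k L] [AddCommGroup M] [Module k M]

/-- One step of the recursion for `adExt`: `(y, ω, η) ↦ [x, y] ∧ ω + y ∧ η`. -/
def adStep (x : L) :
    L →ₗ[k] ExteriorAlgebra k L × ExteriorAlgebra k L →ₗ[k] ExteriorAlgebra k L :=
  LinearMap.mk₂ k (fun y p => ι k ⁅x, y⁆ * p.1 + ι k y * p.2)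
    (fun y y' p => by simp only [lie_add, map_add, add_mul]; abel)
    (fun c y p => by simp only [lie_smul, map_smul, smul_mul_assoc, smul_add])
    (fun y p p' => by simp only [Prod.fst_add, Prod.snd_add, mul_add]; abel)
    (fun c y p => by simp only [Prod.smul_fst, Prod.smul_snd, mul_smul_comm, smul_add])

theorem adStep_adStep (x y : L) (ω η : ExteriorAlgebra k L) :
    adStep (k := k) x y (ι k y * ω, adStep x y (ω, η)) = (0 : QuadraticForm k L) y • η := by
  have h : ι k ⁅x, y⁆ * (ι k y * ω) + ι k y * (ι k ⁅x, y⁆ * ω) = 0 := by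
    rw [← mul_assoc, ← mul_assoc, ← add_mul, ι_add_mul_swap, zero_mul]
  have h2 : ι k y * (ι k y * η) = 0 := by rw [← mul_assoc, ι_sq_zero, zero_mul]
  simp [adStep, mul_add, h2, h]

/-- The derivation of the exterior algebra of `L` that extends `ad x`. -/
def adExt (x : L) : ExteriorAlgebra k L →ₗ[k] ExteriorAlgebra k L :=
  CliffordAlgebra.foldr' 0 (adStep x) (adStep_adStep x) 0

theorem adExt_one (x : L) : adExt (k := k) x 1 = 0 := by
  have := CliffordAlgebra.foldr'_algebraMap (0 : QuadraticForm k L) (adStep x)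
    (adStep_adStep x) 0 1
  simpa [adExt] using this

theorem adExt_ι_mul (x y : L) (ω : ExteriorAlgebra k L) :
    adExt x (ι k y * ω) = ι k ⁅x, y⁆ * ω + ι k y * adExt x ω :=
  CliffordAlgebra.foldr'_ι_mul (0 : QuadraticForm k L) (adStep x) (adStep_adStep x) 0 y ω

/-- Induction on the exterior algebra by multiplication with vectors on the left. -/
theorem ext_induction {P : ExteriorAlgebra k L → Prop} (one : P 1)
    (smul : ∀ (c : k) ω, P ω → P (c • ω)) (add : ∀ ω η, P ω → P η → P (ω + η))
    (mul : ∀ y ω, P ω → P (ι k y * ω)) (ω : ExteriorAlgebra k L) : P ω := by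
  refine CliffordAlgebra.left_induction (Q := (0 : QuadraticForm k L)) (P := P)
    (fun r => ?_) add (fun ω y h => mul y ω h) ω
  rw [Algebra.algebraMap_eq_smul_one]
  exact smul r _ one

theorem adExt_add (x y : L) (ω : ExteriorAlgebra k L) :
    adExt (x + y) ω = adExt x ω + adExt y ω := by
  induction ω using ext_induction with
  | one => simp [adExt_one]
  | smul c ω h => simp [h]
  | add ω η h h' => simp only [map_add, h, h']; abel
  | mul z ω h => simp only [adExt_ι_mul, h, add_lie, map_add, add_mul, mul_add]; abel

theorem adExt_smul (c : k) (x : L) (ω : ExteriorAlgebra k L) :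
    adExt (c • x) ω = c • adExt x ω := by
  induction ω using ext_induction with
  | one => simp [adExt_one]
  | smul c' ω h => simp only [map_smul, h]; exact smul_comm _ _ _
  | add ω η h h' => simp only [map_add, h, h', smul_add]
  | mul z ω h => simp [adExt_ι_mul, h, smul_add]

variable (A : L →ₗ[k] Module.End k M)

/-- One step of the recursion for the boundary:
`(y, ω, φ) ↦ (e ↦ A y e ⊗ ω - e ⊗ adExt y ω - y ∧ φ e)`. -/
def boundaryStep :
    L →ₗ[k] ExteriorAlgebra k L × (M →ₗ[k] M ⊗[k] ExteriorAlgebra k L) →ₗ[k]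
      (M →ₗ[k] M ⊗[k] ExteriorAlgebra k L) :=
  LinearMap.mk₂ k
    (fun y p => (TensorProduct.mk k M _).flip p.1 ∘ₗ A y
      - (TensorProduct.mk k M _).flip (adExt y p.1)
      - (LinearMap.mulLeft k (ι k y)).lTensor M ∘ₗ p.2)
    (fun y y' p => by
      have : LinearMap.mulLeft k (ι k y + ι k y')
          = LinearMap.mulLeft k (ι k y) + LinearMap.mulLeft k (ι k y') := by
        ext; simp [add_mul]
      ext e
      simp only [map_add, adExt_add, this, LinearMap.lTensor_add, LinearMap.sub_apply,
        LinearMap.comp_apply, LinearMap.add_apply, LinearMap.flip_apply, TensorProduct.mk_apply]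
      abel)
    (fun c y p => by
      have : LinearMap.mulLeft k (c • ι k y) = c • LinearMap.mulLeft k (ι k y) := by
        ext; simp
      ext e
      simp only [map_smul, adExt_smul, this, LinearMap.lTensor_smul, LinearMap.sub_apply,
        LinearMap.comp_apply, LinearMap.smul_apply, LinearMap.flip_apply, TensorProduct.mk_apply, smul_sub])
    (fun y p p' => by
      ext e
      simp only [Prod.fst_add, Prod.snd_add, map_add, LinearMap.sub_apply,
        LinearMap.comp_apply, LinearMap.add_apply, LinearMap.flip_apply, TensorProduct.mk_apply]
      abel)
    (fun c y p => by
      ext e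
      simp only [Prod.smul_fst, Prod.smul_snd, map_smul, LinearMap.sub_apply,
        LinearMap.comp_apply, LinearMap.smul_apply, LinearMap.flip_apply, TensorProduct.mk_apply, smul_sub])

theorem boundaryStep_apply (y : L) (ω : ExteriorAlgebra k L)
    (φ : M →ₗ[k] M ⊗[k] ExteriorAlgebra k L) (e : M) :
    boundaryStep A y (ω, φ) e = A y e ⊗ₜ ω - e ⊗ₜ adExt y ω
      - (LinearMap.mulLeft k (ι k y)).lTensor M (φ e) := rfl

theorem lTensor_mulLeft_sq (y : L) (t : M ⊗[k] ExteriorAlgebra k L) :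
    (LinearMap.mulLeft k (ι k y)).lTensor M ((LinearMap.mulLeft k (ι k y)).lTensor M t) = 0 := by
  have : LinearMap.mulLeft k (ι k y) ∘ₗ LinearMap.mulLeft k (ι k y) = 0 := by
    ext ω
    simp [← mul_assoc]
  rw [← LinearMap.comp_apply, ← LinearMap.lTensor_comp, this, LinearMap.lTensor_zero,
    LinearMap.zero_apply]

theorem boundaryStep_boundaryStep (y : L) (ω : ExteriorAlgebra k L)
    (φ : M →ₗ[k] M ⊗[k] ExteriorAlgebra k L) :
    boundaryStep A y (ι k y * ω, boundaryStep A y (ω, φ)) = (0 : QuadraticForm k L) y • φ := by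
  ext e
  simp [boundaryStep_apply, adExt_ι_mul, lTensor_mulLeft_sq]

/-- The boundary of the Koszul (Chevalley–Eilenberg) complex `M ⊗ ⋀L`, on all degrees at once.
It is given by the recursion `d (e ⊗ 1) = 0` and
`d (e ⊗ y ∧ ω) = A y e ⊗ ω - e ⊗ adExt y ω - y ∧ d (e ⊗ ω)`, and hence by the usual formula
(see `boundary_tmul_ιMulti`). -/
def boundary : M ⊗[k] ExteriorAlgebra k L →ₗ[k] M ⊗[k] ExteriorAlgebra k L :=
  TensorProduct.lift
    (CliffordAlgebra.foldr' (0 : QuadraticForm k L) (boundaryStep A)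
      (boundaryStep_boundaryStep A) 0).flip

theorem boundary_tmul_one (e : M) : boundary A (e ⊗ₜ 1) = 0 := by
  have := congrArg (fun φ => φ e) (CliffordAlgebra.foldr'_algebraMap (0 : QuadraticForm k L)
    (boundaryStep A) (boundaryStep_boundaryStep A) 0 1)
  simpa [boundary] using this

theorem boundary_tmul_ι_mul (e : M) (y : L) (ω : ExteriorAlgebra k L) :
    boundary A (e ⊗ₜ (ι k y * ω)) = A y e ⊗ₜ ω - e ⊗ₜ adExt y ω
      - (LinearMap.mulLeft k (ι k y)).lTensor M (boundary A (e ⊗ₜ ω)) :=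
  congrArg (fun φ => φ e) (CliffordAlgebra.foldr'_ι_mul (0 : QuadraticForm k L)
    (boundaryStep A) (boundaryStep_boundaryStep A) 0 y ω)

theorem adExt_ιMulti (x : L) {n : ℕ} (v : Fin (n + 1) → L) :
    adExt x (ιMulti k (n + 1) v)
      = ∑ l : Fin (n + 1), (-1 : k) ^ (l : ℕ) •
          (ι k ⁅x, v l⁆ * ιMulti k n (fun i => v (l.succAbove i))) := by
  induction n with
  | zero =>
    have := adExt_ι_mul x (v 0) (1 : ExteriorAlgebra k L)
    simpa [ιMulti_succ_apply, adExt_one] using this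
  | succ n ih =>
    rw [ιMulti_succ_apply, adExt_ι_mul, Fin.sum_univ_succ]
    congr 1
    · simp [Matrix.vecTail, Function.comp_def]
    · have := ih (Matrix.vecTail v)
      rw [this, Finset.mul_sum]
      refine Finset.sum_congr rfl fun l _ => ?_
      rw [ιMulti_succ_apply (fun i => v (l.succ.succAbove i))]
      have hc : ι k (v 0) * ι k ⁅x, v l.succ⁆ = - (ι k ⁅x, v l.succ⁆ * ι k (v 0)) :=
        eq_neg_of_add_eq_zero_left (ι_add_mul_swap _ _)
      simp only [Matrix.vecTail, Function.comp_def, Fin.succ_succAbove_zero, Fin.succ_succAbove_succ,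
        mul_smul_comm, ← mul_assoc, hc, Fin.val_succ, pow_succ, mul_neg, mul_one, neg_smul,
        neg_mul, smul_neg]

/-- The boundary of a decomposable element of degree `1`. -/
theorem boundary_tmul_ι (e : M) (x : L) : boundary A (e ⊗ₜ ι k x) = A x e ⊗ₜ 1 := by
  have := boundary_tmul_ι_mul A e x 1
  simpa [adExt_one, boundary_tmul_one] using this

/-- The boundary of a decomposable element of degree `n + 2`, with indices counted from `0`:
the second sum is over the pairs `k < l'`, where `l' = l + 1`. -/
theorem boundary_tmul_ιMulti (e : M) {n : ℕ} (v : Fin (n + 2) → L) :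
    boundary A (e ⊗ₜ ιMulti k (n + 2) v)
      = ∑ i : Fin (n + 2), (-1 : k) ^ (i : ℕ) •
          (A (v i) e ⊗ₜ ιMulti k (n + 1) (fun j => v (i.succAbove j)))
        + ∑ i : Fin (n + 2), ∑ l : Fin (n + 1), if i ≤ l.castSucc then
            (-1 : k) ^ ((i : ℕ) + (l.succ : ℕ)) • (e ⊗ₜ[k]
              (ι k ⁅v i, v l.succ⁆ *
                ιMulti k n (fun j => v (i.succAbove (l.succAbove j))))) else 0 := by
  rw [ιMulti_succ_apply, boundary_tmul_ι_mul, adExt_ιMulti, Fin.sum_univ_succ (n := n + 1),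
    Fin.sum_univ_succ (n := n + 1), sub_eq_add_neg, sub_eq_add_neg, add_assoc, add_assoc]
  congr 1
  · simp [Matrix.vecTail, Function.comp_def]
  rw [add_left_comm]
  have hc (x y : L) : ι k x * ι k y = - (ι k y * ι k x) :=
    eq_neg_of_add_eq_zero_left (ι_add_mul_swap _ _)
  have h1 : -(e ⊗ₜ[k] ∑ l : Fin (n + 1), (-1 : k) ^ (l : ℕ) •
          (ι k ⁅v 0, Matrix.vecTail v l⁆ *
            ιMulti k n (fun i => Matrix.vecTail v (l.succAbove i))))
      = ∑ l : Fin (n + 1), if (0 : Fin (n + 2)) ≤ l.castSucc then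
            (-1 : k) ^ (((0 : Fin (n + 2)) : ℕ) + (l.succ : ℕ)) • (e ⊗ₜ[k]
              (ι k ⁅v 0, v l.succ⁆ *
                ιMulti k n (fun j => v ((0 : Fin (n + 2)).succAbove (l.succAbove j))))) else 0 := by
    rw [TensorProduct.tmul_sum, ← Finset.sum_neg_distrib]
    refine Finset.sum_congr rfl fun l _ => ?_
    simp [Matrix.vecTail, pow_succ]
  rw [h1]
  congr 1
  cases n with
  | zero =>
    have := boundary_tmul_ι A e (v 1)
    simp [ιMulti_succ_apply, Matrix.vecTail, this]
  | succ n =>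
    rw [boundary_tmul_ιMulti e (Matrix.vecTail v), map_add, neg_add]
    congr 1
    · rw [map_sum, ← Finset.sum_neg_distrib]
      refine Finset.sum_congr rfl fun i _ => ?_
      rw [ιMulti_succ_apply (fun j => v (i.succ.succAbove j))]
      simp [Matrix.vecTail, Function.comp_def, pow_succ]
    · rw [map_sum, ← Finset.sum_neg_distrib]
      refine Finset.sum_congr rfl fun i _ => ?_
      rw [map_sum, ← Finset.sum_neg_distrib, Fin.sum_univ_succ (n := n + 1), if_neg (by simp), zero_add]
      refine Finset.sum_congr rfl fun l _ => ?_
      rw [ιMulti_succ_apply (fun j => v (i.succ.succAbove (l.succ.succAbove j)))]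
      by_cases h : i ≤ l.castSucc
      · rw [if_pos h, if_pos (by simpa [Fin.succ_le_succ_iff] using h)]
        simp only [map_smul, LinearMap.lTensor_tmul, LinearMap.mulLeft_apply, ← mul_assoc]
        rw [hc]
        simp [Matrix.vecTail, Function.comp_def, pow_succ, pow_add, TensorProduct.tmul_neg]
      · rw [if_neg h, if_neg (by simpa [Fin.succ_le_succ_iff] using h)]
        simp

theorem adExt_lie (x y : L) (ω : ExteriorAlgebra k L) :
    adExt ⁅x, y⁆ ω = adExt x (adExt y ω) - adExt y (adExt x ω) := by
  induction ω using ext_induction with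
  | one => simp [adExt_one]
  | smul c ω h => simp [h, smul_sub]
  | add ω η h h' => simp only [map_add, h, h']; abel
  | mul z ω h =>
    simp only [adExt_ι_mul, h, map_add, lie_lie, map_sub, sub_mul, mul_sub]
    abel

/-- The action of `x` on the complex. -/
def lieOp (x : L) : M ⊗[k] ExteriorAlgebra k L →ₗ[k] M ⊗[k] ExteriorAlgebra k L :=
  (A x).rTensor _ - (adExt x).lTensor M

/-- Left multiplication by `x` on the complex. -/
def extOp (x : L) : M ⊗[k] ExteriorAlgebra k L →ₗ[k] M ⊗[k] ExteriorAlgebra k L :=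
  (LinearMap.mulLeft k (ι k x)).lTensor M

theorem boundary_extOp (x : L) (t : M ⊗[k] ExteriorAlgebra k L) :
    boundary A (extOp x t) = lieOp A x t - extOp x (boundary A t) := by
  induction t with
  | zero => simp
  | tmul e ω => simp [extOp, lieOp, boundary_tmul_ι_mul]
  | add s t hs ht => simp only [map_add, hs, ht]; abel

theorem lieOp_extOp (x y : L) (t : M ⊗[k] ExteriorAlgebra k L) :
    lieOp A x (extOp y t) = extOp y (lieOp A x t) - extOp ⁅x, y⁆ t := by
  induction t with
  | zero => simp
  | tmul e ω => simp [extOp, lieOp, adExt_ι_mul, TensorProduct.tmul_add]; abel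
  | add s t hs ht => simp only [map_add, hs, ht]; abel

theorem lieOp_lieOp (hA : ∀ x y e, A ⁅x, y⁆ e = A y (A x e) - A x (A y e))
    (x y : L) (t : M ⊗[k] ExteriorAlgebra k L) :
    lieOp A x (lieOp A y t) = lieOp A y (lieOp A x t) - lieOp A ⁅x, y⁆ t := by
  induction t with
  | zero => simp
  | tmul e ω =>
    simp [lieOp, adExt_lie, hA, TensorProduct.tmul_sub, TensorProduct.sub_tmul]; abel
  | add s t hs ht => simp only [map_add, hs, ht]; abel

theorem boundary_lieOp (hA : ∀ x y e, A ⁅x, y⁆ e = A y (A x e) - A x (A y e))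
    (x : L) (t : M ⊗[k] ExteriorAlgebra k L) :
    boundary A (lieOp A x t) = lieOp A x (boundary A t) := by
  induction t with
  | zero => simp
  | add s t hs ht => simp only [map_add, hs, ht]
  | tmul e ω =>
    induction ω using ext_induction with
    | one => simp [lieOp, adExt_one, boundary_tmul_one]
    | smul c ω h => simp only [TensorProduct.tmul_smul, map_smul, h]
    | add ω η h h' => simp only [TensorProduct.tmul_add, map_add, h, h']
    | mul y ω h =>
      have : e ⊗ₜ[k] (ι k y * ω) = extOp y (e ⊗ₜ[k] ω) := by simp [extOp]
      rw [this, lieOp_extOp, map_sub, boundary_extOp, boundary_extOp, boundary_extOp, h,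
        map_sub, lieOp_extOp, lieOp_lieOp A hA x y]
      abel

/-- The boundary squares to zero if `A` is a right representation of `L`. -/
theorem boundary_comp_boundary
    (hA : ∀ x y e, A ⁅x, y⁆ e = A y (A x e) - A x (A y e)) :
    boundary A ∘ₗ boundary A = 0 := by
  ext1
  refine LinearMap.ext fun e => LinearMap.ext fun ω => ?_
  simp only [TensorProduct.AlgebraTensorModule.curry_apply, TensorProduct.curry_apply,
    LinearMap.coe_restrictScalars, LinearMap.comp_apply, LinearMap.zero_apply]
  induction ω using ext_induction with
  | one => simp [boundary_tmul_one]
  | smul c ω h => simp [TensorProduct.tmul_smul, h]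
  | add ω η h h' => simp [TensorProduct.tmul_add, h, h']
  | mul y ω h =>
    have : e ⊗ₜ[k] (ι k y * ω) = extOp y (e ⊗ₜ[k] ω) := by simp [extOp]
    rw [this, boundary_extOp, map_sub, boundary_extOp, boundary_lieOp A hA, h, map_zero]
    abel

/-- The total homology of the complex, cycles modulo boundaries. -/
abbrev Homology : Type _ :=
  LinearMap.ker (boundary A) ⧸ (LinearMap.range (boundary A)).submoduleOf
    (LinearMap.ker (boundary A))

end Algebra

section Spectrum

variable {L E : Type*} [LieRing L] [LieAlgebra ℂ L] [NormedAddCommGroup E] [NormedSpace ℂ E]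

/-- The operators `e ↦ e · x - f x • e`, for a right action `ρ` of `L` on `E`. -/
def shiftedAction (ρ : L →ₗ⁅ℂ⁆ (E →L[ℂ] E)ᵐᵒᵖ) (f : Module.Dual ℂ L) :
    L →ₗ[ℂ] Module.End ℂ E where
  toFun x := ((ρ x).unop : E →ₗ[ℂ] E) - f x • LinearMap.id
  map_add' x y := by
    ext e
    simp [add_smul]
    abel
  map_smul' c x := by
    ext e
    simp [smul_sub, mul_smul]

theorem shiftedAction_lie (ρ : L →ₗ⁅ℂ⁆ (E →L[ℂ] E)ᵐᵒᵖ) (f : Module.Dual ℂ L)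
    (hf : ∀ x y : L, f ⁅x, y⁆ = 0) (x y : L) (e : E) :
    shiftedAction ρ f ⁅x, y⁆ e = shiftedAction ρ f y (shiftedAction ρ f x e)
      - shiftedAction ρ f x (shiftedAction ρ f y e) := by
  simp [shiftedAction, hf, LieRing.of_associative_ring_bracket, smul_sub, smul_comm (f x) (f y)]
  abel

/-- The joint spectrum of `L` acting on `E` from the right by bounded operators: the characters
`f` of `L` for which the homology of `L` with coefficients in `E ⊗ ℂ(f)` is non-zero. -/
def jointSpectrum (ρ : L →ₗ⁅ℂ⁆ (E →L[ℂ] E)ᵐᵒᵖ) : Set (Module.Dual ℂ L) :=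
  {f | (∀ x y : L, f ⁅x, y⁆ = 0) ∧ Nontrivial (Homology (shiftedAction ρ f))}

end Spectrum

end LieKoszul

/-!
Since `L` is solvable, there is a chain of subalgebras from the ideal to `L`, each containing the ideal
and each the kernel of a character of the next one (`exists_character_of_ne_top`). So it suffices to
treat `L = N ⊕ ℂ x` with `N` an ideal.

In this case the complex of `L` with coefficients in `E ⊗ ℂ(f)` is the mapping cone of the operator
`Θ - f x` on the complex of `N` with coefficients in `E ⊗ ℂ(f|N)`, where `Θ` is the natural action of
`x` (`boundary_inclOp_add`). If the complex of `N` is acyclic, so is the cone, and hence characters in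
the spectrum of `L` restrict to characters in the spectrum of `N` (`comp_mem_jointSpectrum`).

Conversely, let `f` be in the spectrum of `N`. There are two points.

* `f` vanishes on `[x, N]`, so that it extends to a character of `L` with any value at `x`
  (`apply_lie_eq_zero_of_mem_jointSpectrum`). The one-parameter group `exp (t Θ)` carries the complex
  of `f` to the complex of `f ∘ exp (t ad x)`, and so all these forms are in the spectrum of `N`. For
  `y` in `N`, Cartan's formula bounds the values at `y` of the characters in the spectrum by the norm
  of the action of `y` on the complex. By Liouville's theorem `f (exp (t ad x) y)` is constant in `t`.
* `Θ` has a spectral value on the non-zero homology of `N`, which serves as the value at `x` of the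
  extension of `f` (`exact_of_cone_exact`). The homology is a quotient of a Banach space by a range
  that need not be closed. This is overcome by passing to bounded sequences of cycles, on which
  the closure of the boundaries is a proper subspace whenever the homology is non-zero. The
  quotient by it is a non-zero Banach space, on which operators have non-empty spectrum.

Exactness of a complex of Banach spaces is quantitative by the open mapping theorem. To have it,
`E ⊗ ⋀N` is normed by its coordinates in a basis of `⋀N`, and the operators in use are continuous.
-/

namespace LieKoszul

/-! ### Spectral values on non-Hausdorff homology -/

section Analysis

open scoped BoundedContinuousFunction

/-- An operator `T` that preserves a proper closed subspace `N` of a Banach space `V` has a spectral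
value on the Banach space `V ⧸ N`. This is the contrapositive: if `T - c` is bijective modulo `N` for
all scalars `c`, then `N` is not proper. -/
theorem eq_top_of_sub_smul_bijective_mod {V : Type*} [NormedAddCommGroup V] [NormedSpace ℂ V]
    [CompleteSpace V] (N : Submodule ℂ V) (hN : IsClosed (N : Set V)) (T : V →L[ℂ] V)
    (hT : ∀ v ∈ N, T v ∈ N) (inj : ∀ (c : ℂ) v, T v - c • v ∈ N → v ∈ N)
    (surj : ∀ (c : ℂ) v, ∃ u, T u - c • u - v ∈ N) : N = ⊤ := by
  by_contra hne
  have : IsClosed (N : Set V) := hN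
  have : Nontrivial (V ⧸ N) := Submodule.Quotient.nontrivial_iff.2 hne
  let S : (V ⧸ N) →L[ℂ] (V ⧸ N) := ⟨N.mapQ N T hT, by
    refine (Submodule.isQuotientMap_mkQ N).continuous_iff.2 ?_
    exact N.continuous_mkQ.comp T.continuous⟩
  obtain ⟨c, hc⟩ := spectrum.nonempty S
  refine hc ?_
  rw [spectrum.mem_resolventSet_iff, ← IsUnit.neg_iff, neg_sub, ContinuousLinearMap.isUnit_iff_bijective]
  have key (v : V) : (S - algebraMap ℂ ((V ⧸ N) →L[ℂ] (V ⧸ N)) c) (N.mkQ v)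
      = N.mkQ (T v - c • v) := by
    simp only [sub_apply, Algebra.algebraMap_eq_smul_one, map_sub, map_smul]
    rfl
  constructor
  · rw [injective_iff_map_eq_zero]
    intro q hq
    obtain ⟨v, rfl⟩ := N.mkQ_surjective q
    rw [key] at hq
    simp only [Submodule.mkQ_apply, Submodule.Quotient.mk_eq_zero] at hq ⊢
    exact inj c v hq
  · intro q
    obtain ⟨v, rfl⟩ := N.mkQ_surjective q
    obtain ⟨u, hu⟩ := surj c v
    refine ⟨N.mkQ u, ?_⟩
    rw [key]
    exact (Submodule.Quotient.eq N).2 hu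

/-- Successive approximation: a subspace each of whose elements is in the range of `d` up to half
its norm, with control of the preimage, lies in the range. -/
theorem exists_preimage_of_approx {K : Type*} [NormedAddCommGroup K] [NormedSpace ℂ K]
    [CompleteSpace K] (d : K →L[ℂ] K) (C : ℝ) (Z : Submodule ℂ K) (hd : ∀ w, d w ∈ Z)
    (h : ∀ z ∈ Z, ‖z‖ ≤ 1 → ∃ w, ‖w‖ ≤ C ∧ ‖z - d w‖ ≤ 1 / 2) (z : K) (hz : z ∈ Z) :
    ∃ w, d w = z := by
  have hC : 0 ≤ C := by
    obtain ⟨w, hw, -⟩ := h 0 Z.zero_mem (by simp)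
    exact (norm_nonneg w).trans hw
  have h' : ∀ z : Z, ∃ w, ‖w‖ ≤ C * ‖z‖ ∧ ‖(z : K) - d w‖ ≤ 1 / 2 * ‖z‖ := by
    intro z
    by_cases h0 : z = 0
    · exact ⟨0, by simp [h0]⟩
    have hpos : 0 < ‖z‖ := norm_pos_iff.2 h0
    have hn : ‖((‖z‖ : ℂ)⁻¹)‖ = ‖z‖⁻¹ := by simp
    obtain ⟨w, hw, hw'⟩ := h ((‖z‖ : ℂ)⁻¹ • (z : K)) (Z.smul_mem _ z.2) (by
      rw [norm_smul, hn, Submodule.coe_norm, inv_mul_cancel₀ (by simpa using h0)])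
    have hne : (‖z‖ : ℂ) ≠ 0 := by exact_mod_cast hpos.ne'
    refine ⟨(‖z‖ : ℂ) • w, ?_, ?_⟩
    · rw [norm_smul, Complex.norm_real, norm_norm, mul_comm]
      gcongr
    · have : (z : K) - d ((‖z‖ : ℂ) • w) = (‖z‖ : ℂ) • ((‖z‖ : ℂ)⁻¹ • (z : K) - d w) := by
        rw [smul_sub, smul_smul, mul_inv_cancel₀ hne, one_smul, map_smul]
      rw [this, norm_smul, Complex.norm_real, norm_norm, mul_comm]
      gcongr
  choose R hR hR' using h'
  let s : ℕ → Z := fun n => (fun y : Z => ⟨y - d (R y), Z.sub_mem y.2 (hd _)⟩)^[n] ⟨z, hz⟩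
  have hs (n : ℕ) : (s (n + 1) : K) = s n - d (R (s n)) := by
    simp only [s, Function.iterate_succ_apply']
  have hnorm (n : ℕ) : ‖s n‖ ≤ (1 / 2) ^ n * ‖z‖ := by
    induction n with
    | zero => simp [s]
    | succ n ih =>
      calc ‖s (n + 1)‖ = ‖(s n : K) - d (R (s n))‖ := by rw [← hs]; rfl
        _ ≤ 1 / 2 * ‖s n‖ := hR' _
        _ ≤ 1 / 2 * ((1 / 2) ^ n * ‖z‖) := by gcongr
        _ = _ := by ring
  have hsum : Summable fun n => R (s n) := by
    refine Summable.of_norm_bounded (g := fun n => C * ‖z‖ * (1 / 2 : ℝ) ^ n)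
      (summable_geometric_two.mul_left _) fun n => (hR _).trans ?_
    calc C * ‖s n‖ ≤ C * ((1 / 2) ^ n * ‖z‖) := by gcongr; exact hnorm n
      _ = _ := by ring
  refine ⟨∑' n, R (s n), ?_⟩
  have h1 := (hsum.hasSum.mapL d).tendsto_sum_nat
  have h2 (n : ℕ) : ∑ i ∈ Finset.range n, d (R (s i)) = z - s n := by
    induction n with
    | zero => simp [s]
    | succ n ih => rw [Finset.sum_range_succ, ih, hs]; abel
  have h3 : Filter.Tendsto (fun n => (s n : K)) Filter.atTop (nhds 0) := by
    refine squeeze_zero_norm hnorm ?_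
    simpa using (tendsto_pow_atTop_nhds_zero_of_lt_one (r := (1 / 2 : ℝ)) (by norm_num)
      (by norm_num)).mul_const ‖z‖
  simp only [h2] at h1
  exact tendsto_nhds_unique h1 (by simpa using h3.const_sub z)

/-- A chain operator `T` on a Banach complex `(K, d)` with non-zero homology has a spectral value on
the homology, which need not be Hausdorff: if the mapping cone of `T - c` is exact for each scalar
`c`, then `(K, d)` is exact.

The range of `d` may be dense in `ker d`, so it is of no use to pass to its closure there. For bounded
sequences in `ker d` the closure loses nothing: if the images under `d` of bounded sequences are dense
among them, then the unit ball of `ker d` is uniformly approximated by the image of a ball. -/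
theorem exact_of_cone_exact {K : Type*} [NormedAddCommGroup K] [NormedSpace ℂ K]
    [CompleteSpace K] (d T : K →L[ℂ] K) (hd : ∀ z, d (d z) = 0) (hT : ∀ z, d (T z) = T (d z))
    (cone : ∀ (c : ℂ) (a b : K), d a = 0 → T a - c • a = d b →
      ∃ a' b', d a' = a ∧ T a' - c • a' - d b' = b) (z : K) (hz : d z = 0) :
    ∃ w, d w = z := by
  -- The open mapping theorem makes exactness of the cones quantitative.
  have bdd (c : ℂ) : ∃ C > 0, ∀ a b : K, d a = 0 → T a - c • a = d b →
      ∃ a' b', d a' = a ∧ T a' - c • a' - d b' = b ∧ ‖a'‖ ≤ C * (‖a‖ + ‖b‖) ∧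
        ‖b'‖ ≤ C * (‖a‖ + ‖b‖) := by
    let G : K × K →L[ℂ] K × K :=
      (d.comp (.fst ℂ K K)).prod ((T - c • .id ℂ K).comp (.fst ℂ K K) - d.comp (.snd ℂ K K))
    have hG (a b : K) : G (a, b) = (d a, T a - c • a - d b) := rfl
    have hcl : IsClosed (G.ker : Set (K × K)) := G.isClosed_ker
    have : CompleteSpace G.ker := hcl.completeSpace_coe
    let G' : K × K →L[ℂ] G.ker := G.codRestrict G.ker fun p => by
      obtain ⟨a, b⟩ := p
      simp [hG, hd, hT]
    have hsurj : Function.Surjective G' := by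
      rintro ⟨⟨a, b⟩, hab⟩
      have hab' : G (a, b) = 0 := hab
      simp only [hG, Prod.mk_eq_zero] at hab'
      obtain ⟨a', b', h1, h2⟩ := cone c a b hab'.1 (sub_eq_zero.1 hab'.2)
      refine ⟨(a', b'), Subtype.ext ?_⟩
      change G (a', b') = (a, b)
      rw [hG, h1, h2]
    obtain ⟨C, hC, h⟩ := ContinuousLinearMap.exists_preimage_norm_le G' hsurj
    refine ⟨C, hC, fun a b ha hb => ?_⟩
    obtain ⟨⟨a', b'⟩, h1, h2⟩ := h ⟨(a, b), show G (a, b) = 0 by simp [hG, ha, hb]⟩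
    have h1' : G (a', b') = (a, b) := congrArg Subtype.val h1
    rw [hG, Prod.mk.injEq] at h1'
    have h3 : ‖(a', b')‖ ≤ C * (‖a‖ + ‖b‖) := h2.trans (by
      gcongr
      exact max_le (le_add_of_nonneg_right (norm_nonneg _)) (le_add_of_nonneg_left (norm_nonneg _)))
    exact ⟨a', b', h1'.1, h1'.2, (le_max_left _ _).trans h3, (le_max_right _ _).trans h3⟩
  -- On the bounded sequences in `Z = ker d`, the operator `S` induced by `T` has no spectral value
  -- modulo the closure of the range of `D`, which is `d` applied termwise.
  let Z := d.ker
  have hZ (a : K) : a ∈ Z ↔ d a = 0 := Iff.rfl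
  have hZc : IsClosed (Z : Set K) := d.isClosed_ker
  have : CompleteSpace Z := hZc.completeSpace_coe
  let dZ : K →L[ℂ] Z := d.codRestrict Z hd
  let TZ : Z →L[ℂ] Z := (T.comp Z.subtypeL).codRestrict Z fun a => by
    have : d a = 0 := a.2
    simp [hZ, hT, this]
  let D : (ℕ →ᵇ K) →L[ℂ] (ℕ →ᵇ Z) := dZ.compLeftContinuousBounded ℕ
  let S : (ℕ →ᵇ Z) →L[ℂ] (ℕ →ᵇ Z) := TZ.compLeftContinuousBounded ℕ
  -- A bounded sequence of cone cycles is the boundary of a bounded sequence.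
  have seq (c : ℂ) (a : ℕ →ᵇ Z) (b : ℕ →ᵇ K) (hab : S a - c • a = D b) : ∃ w, D w = a := by
    obtain ⟨C, hC, h⟩ := bdd c
    have h1 (n : ℕ) : T (a n) - c • (a n : K) = d (b n) :=
      congrArg Subtype.val (DFunLike.congr_fun hab n)
    choose a' b' h2 h3 h4 h5 using fun n => h (a n) (b n) (a n).2 (h1 n)
    refine ⟨.ofNormedAddCommGroupDiscrete a' (C * (‖a‖ + ‖b‖)) fun n => (h4 n).trans ?_, ?_⟩
    · gcongr
      · exact a.norm_coe_le_norm n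
      · exact b.norm_coe_le_norm n
    · ext n
      exact h2 n
  have solve (c : ℂ) : ∃ C > 0, ∀ v : ℕ →ᵇ Z, ∃ (u : ℕ →ᵇ Z) (b : ℕ →ᵇ K),
      S u - c • u - D b = v ∧ ‖u‖ ≤ C * ‖v‖ := by
    obtain ⟨C, hC, h⟩ := bdd c
    refine ⟨C, hC, fun v => ?_⟩
    have hv (n : ℕ) : d (v n) = 0 := (v n).2
    choose a' b' h2 h3 h4 h5 using fun n => h 0 (v n) (map_zero d) (by simp [hv n])
    have bound (n : ℕ) : C * (‖(0 : K)‖ + ‖(v n : K)‖) ≤ C * ‖v‖ := by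
      rw [norm_zero, zero_add]
      gcongr
      exact v.norm_coe_le_norm n
    refine ⟨.ofNormedAddCommGroupDiscrete (fun n => ⟨a' n, h2 n⟩) (C * ‖v‖)
        fun n => (h4 n).trans (bound n),
      .ofNormedAddCommGroupDiscrete b' (C * ‖v‖) fun n => (h5 n).trans (bound n), ?_, ?_⟩
    · ext n
      exact h3 n
    · exact BoundedContinuousFunction.norm_ofNormedAddCommGroup_le
        continuous_of_discreteTopology (by positivity)
        fun n => (h4 n).trans (bound n)
  have hSD (w : ℕ →ᵇ K) : S (D w) = D (T.compLeftContinuousBounded ℕ w) := by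
    ext n
    exact (hT (w n)).symm
  have htop : D.range.topologicalClosure = ⊤ := by
    refine eq_top_of_sub_smul_bijective_mod _ (Submodule.isClosed_topologicalClosure _) S ?_ ?_ ?_
    · intro v hv
      refine map_mem_closure S.continuous hv ?_
      rintro _ ⟨w, rfl⟩
      exact ⟨_, (hSD w).symm⟩
    · intro c v hv
      obtain ⟨C, hC, hsol⟩ := solve c
      refine Metric.mem_closure_iff.2 fun ε hε => ?_
      obtain ⟨_, ⟨h, rfl⟩, hh⟩ := Metric.mem_closure_iff.1 hv (ε / C) (by positivity)
      obtain ⟨u, b, hub, hu⟩ := hsol (S v - c • v - D h)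
      obtain ⟨w, hw⟩ := seq c (v - u) (h - b) (by
        have e : S (v - u) - c • (v - u) = (S v - c • v) - (S u - c • u) := by
          rw [map_sub]
          module
        rw [e, sub_eq_iff_eq_add.1 hub, map_sub]
        abel)
      refine ⟨v - u, ⟨w, hw⟩, ?_⟩
      rw [dist_eq_norm, sub_sub_cancel]
      refine hu.trans_lt ?_
      rw [dist_eq_norm] at hh
      rwa [lt_div_iff₀' hC] at hh
    · intro c v
      obtain ⟨_, -, hsol⟩ := solve c
      obtain ⟨u, b, hub, -⟩ := hsol v
      refine ⟨u, Submodule.le_topologicalClosure _ ⟨b, ?_⟩⟩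
      rw [← hub]
      abel
  -- Otherwise a sequence of counterexamples, one for each `n`, is not in the closure of the range
  -- of `D`.
  have happ : ∃ n : ℕ, ∀ z ∈ Z, ‖z‖ ≤ 1 → ∃ w, ‖w‖ ≤ (n : ℝ) ∧ ‖z - d w‖ ≤ 1 / 2 := by
    by_contra! hcon
    choose s hs hs1 hs2 using hcon
    let σ : ℕ →ᵇ Z := .ofNormedAddCommGroupDiscrete (fun n => ⟨s n, hs n⟩) 1 hs1
    have hσ : σ ∈ D.range.topologicalClosure := htop ▸ Submodule.mem_top
    obtain ⟨_, ⟨h, rfl⟩, hh⟩ := Metric.mem_closure_iff.1 hσ (1 / 2) (by norm_num)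
    obtain ⟨n, hn⟩ := exists_nat_ge ‖h‖
    refine lt_irrefl (1 / 2 : ℝ) ((hs2 n (h n) ((h.norm_coe_le_norm n).trans hn)).trans ?_)
    rw [dist_eq_norm] at hh
    exact ((σ - D h).norm_coe_le_norm n).trans_lt hh
  obtain ⟨n, hn⟩ := happ
  exact exists_preimage_of_approx d n Z hd hn z hz

end Analysis

/-! ### Conjugation by exponentials and rigidity of characters -/

section Conjugation

variable {B : Type*} [NormedRing B] [NormedAlgebra ℂ B] [CompleteSpace B]

theorem exp_mul_exp_neg_eq_one (a : B) : NormedSpace.exp a * NormedSpace.exp (-a) = 1 := by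
  let _ : NormedAlgebra ℚ B := NormedAlgebra.restrictScalars ℚ ℂ B
  rw [← NormedSpace.exp_add_of_commute (Commute.neg_right (Commute.refl a)), add_neg_cancel,
    NormedSpace.exp_zero]

/-- Conjugation by `exp a` is the exponential of `ad a`, hence preserves closed subspaces that are
stable under `ad a`. -/
theorem exp_mul_mul_exp_neg_mem (C : Submodule ℂ B) (hC : IsClosed (C : Set B)) (a : B)
    (ha : ∀ c ∈ C, a * c - c * a ∈ C) (c : B) (hc : c ∈ C) :
    NormedSpace.exp a * c * NormedSpace.exp (-a) ∈ C := by
  let _ : NormedAlgebra ℚ (B →L[ℂ] B) := NormedAlgebra.restrictScalars ℚ ℂ _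
  let l : B →L[ℂ] B := ContinuousLinearMap.mul ℂ B a
  let r : B →L[ℂ] B := (ContinuousLinearMap.mul ℂ B).flip (-a)
  have hl (n : ℕ) (b : B) : (l ^ n) b = a ^ n * b := by
    induction n generalizing b with
    | zero => simp
    | succ n ih =>
      rw [pow_succ, mul_apply_eq_comp, ih, pow_succ, mul_assoc]
      rfl
  have hr (n : ℕ) (b : B) : (r ^ n) b = b * (-a) ^ n := by
    induction n generalizing b with
    | zero => simp
    | succ n ih =>
      rw [pow_succ, mul_apply_eq_comp, ih, pow_succ', ← mul_assoc]
      rfl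
  have hexpl (b : B) : NormedSpace.exp l b = NormedSpace.exp a * b := by
    have h1 := (NormedSpace.exp_series_hasSum_exp' (𝕂 := ℂ) l).mapL
      (ContinuousLinearMap.apply ℂ B b)
    have h2 := (NormedSpace.exp_series_hasSum_exp' (𝕂 := ℂ) a).mul_right b
    have e (n : ℕ) : ContinuousLinearMap.apply ℂ B b ((n.factorial : ℂ)⁻¹ • l ^ n)
        = (n.factorial : ℂ)⁻¹ • a ^ n * b := by simp [hl]
    simp only [e] at h1
    exact h1.unique h2
  have hexpr (b : B) : NormedSpace.exp r b = b * NormedSpace.exp (-a) := by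
    have h1 := (NormedSpace.exp_series_hasSum_exp' (𝕂 := ℂ) r).mapL
      (ContinuousLinearMap.apply ℂ B b)
    have h2 := (NormedSpace.exp_series_hasSum_exp' (𝕂 := ℂ) (-a)).mul_left b
    have e (n : ℕ) : ContinuousLinearMap.apply ℂ B b ((n.factorial : ℂ)⁻¹ • r ^ n)
        = b * (n.factorial : ℂ)⁻¹ • (-a) ^ n := by simp [hr]
    simp only [e] at h1
    exact h1.unique h2
  have hcomm : Commute r l := by
    ext b
    change a * b * (-a) = a * (b * (-a))
    rw [mul_assoc]
  have hexp : NormedSpace.exp (r + l) c = NormedSpace.exp a * c * NormedSpace.exp (-a) := by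
    rw [NormedSpace.exp_add_of_commute hcomm, mul_apply_eq_comp, hexpl, hexpr]
  have hmem (n : ℕ) : ((r + l) ^ n) c ∈ C := by
    induction n with
    | zero => simpa using hc
    | succ n ih =>
      rw [pow_succ', mul_apply_eq_comp]
      have : (r + l) (((r + l) ^ n) c) = a * ((r + l) ^ n) c - ((r + l) ^ n) c * a := by
        change ((r + l) ^ n) c * (-a) + a * ((r + l) ^ n) c = _
        rw [mul_neg]
        abel
      rw [this]
      exact ha _ ih
  rw [← hexp]
  have h1 := (NormedSpace.exp_series_hasSum_exp' (𝕂 := ℂ) (r + l)).mapL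
    (ContinuousLinearMap.apply ℂ B c)
  refine hC.mem_of_tendsto h1 (Filter.Eventually.of_forall fun s => C.sum_mem fun n _ => ?_)
  simpa using C.smul_mem _ (hmem n)

end Conjugation

section Rigidity

variable {K : Type*} [NormedAddCommGroup K] [NormedSpace ℂ K]

/-- Homotopy invariance: if `d * h + h * d` is invertible for some `h`, then `d` is exact. -/
theorem exact_of_isUnit_homotopy (d h : Module.End ℂ K) (hd : d * d = 0)
    (hu : IsUnit (d * h + h * d)) (z : K) (hz : d z = 0) : ∃ w, d w = z := by
  obtain ⟨u, hu⟩ := hu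
  have hcomm : Commute d u := by
    rw [hu]
    simp only [Commute, SemiconjBy, mul_add, add_mul, mul_assoc, hd]
    simp [← mul_assoc, hd]
  have hcomm' : d * (↑u⁻¹ : Module.End ℂ K) = (↑u⁻¹ : Module.End ℂ K) * d := hcomm.units_inv_right
  refine ⟨(↑u⁻¹ : Module.End ℂ K) (h z), ?_⟩
  rw [← Module.End.mul_apply, hcomm', Module.End.mul_apply]
  have : (u : Module.End ℂ K) z = d (h z) := by simp [hu, hz]
  rw [← this, ← Module.End.mul_apply, Units.inv_mul, Module.End.one_apply]

/-- Let `Θ` commute with `d₀`, and let `C` be a finite-dimensional space of operators that is stable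
under `ad Θ` and whose elements have scalar anticommutators with `h`. Let `d₀ - c` be a differential
with non-zero homology, where `c ∈ C`. With `G t` the conjugate of `c` by `exp (t Θ)`, the differential
`d₀ - G t` is conjugate to `d₀ - c`, hence has non-zero homology too. So the scalar `G t * h + h * G t`
is in the spectrum of `d₀ * h + h * d₀`. It is bounded in `t`, hence constant by Liouville's theorem,
and its derivative at `0` vanishes. -/
theorem anticommutator_commutator_eq_zero [CompleteSpace K] (d₀ Θ h : K →L[ℂ] K)
    (C : Submodule ℂ (K →L[ℂ] K)) [FiniteDimensional ℂ C]
    (hC : ∀ c ∈ C, Θ * c - c * Θ ∈ C) (hd₀ : Θ * d₀ = d₀ * Θ)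
    (hh : ∀ c ∈ C, ∃ μ : ℂ, c * h + h * c = μ • 1) (c : K →L[ℂ] K) (hc : c ∈ C)
    (hd : (d₀ - c) * (d₀ - c) = 0) (z : K) (hz : (d₀ - c) z = 0) (hz' : ∀ w, (d₀ - c) w ≠ z) :
    (Θ * c - c * Θ) * h + h * (Θ * c - c * Θ) = 0 := by
  let U (t : ℂ) : K →L[ℂ] K := NormedSpace.exp (t • Θ)
  let V (t : ℂ) : K →L[ℂ] K := NormedSpace.exp (t • (-Θ))
  have hUV (t : ℂ) : U t * V t = 1 := by
    simpa [U, V] using exp_mul_exp_neg_eq_one (t • Θ)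
  have hVU (t : ℂ) : V t * U t = 1 := by
    simpa [U, V] using exp_mul_exp_neg_eq_one (-(t • Θ))
  have hUd (t : ℂ) : U t * d₀ = d₀ * U t := by
    have : Commute (t • Θ) d₀ := Commute.smul_left hd₀ t
    exact this.exp_left
  let G (t : ℂ) : K →L[ℂ] K := U t * c * V t
  have hG (t : ℂ) : G t ∈ C := by
    have := exp_mul_mul_exp_neg_mem C C.closed_of_finiteDimensional (t • Θ) (fun b hb => by
      rw [smul_mul_assoc, mul_smul_comm, ← smul_sub]
      exact C.smul_mem _ (hC b hb)) c hc
    simpa [G, U, V] using this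
  have hconj (t : ℂ) : d₀ - G t = U t * (d₀ - c) * V t := by
    rw [mul_sub, sub_mul, hUd, mul_assoc d₀, hUV, mul_one]
  let F (t : ℂ) : K →L[ℂ] K := G t * h + h * G t
  have hderiv (t : ℂ) : HasDerivAt G (U t * Θ * c * V t + U t * c * (V t * -Θ)) t :=
    ((hasDerivAt_exp_smul_const Θ t).mul_const c).mul (hasDerivAt_exp_smul_const (-Θ) t)
  have hFderiv (t : ℂ) : HasDerivAt F
      ((U t * Θ * c * V t + U t * c * (V t * -Θ)) * h
        + h * (U t * Θ * c * V t + U t * c * (V t * -Θ))) t :=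
    ((hderiv t).mul_const h).add ((hderiv t).const_mul h)
  have hbdd : Bornology.IsBounded (Set.range F) := by
    refine isBounded_iff_forall_norm_le.2
      ⟨‖d₀ * h + h * d₀‖ * ‖(1 : K →L[ℂ] K)‖ * ‖(1 : K →L[ℂ] K)‖, ?_⟩
    rintro _ ⟨t, rfl⟩
    obtain ⟨μ, hμ⟩ := hh _ (hG t)
    have hFμ : F t = μ • 1 := hμ
    rw [hFμ, norm_smul]
    gcongr
    refine spectrum.norm_le_norm_mul_of_mem fun hμ' => ?_
    rw [spectrum.mem_resolventSet_iff, ← IsUnit.neg_iff, neg_sub] at hμ'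
    have e : d₀ * h + h * d₀ - algebraMap ℂ (K →L[ℂ] K) μ
        = (d₀ - G t) * h + h * (d₀ - G t) := by
      rw [Algebra.algebraMap_eq_smul_one, ← hμ]
      noncomm_ring
    rw [e] at hμ'
    have hdG : (d₀ - G t) * (d₀ - G t) = 0 := by
      calc (d₀ - G t) * (d₀ - G t)
          = U t * ((d₀ - c) * ((V t * U t) * (d₀ - c))) * V t := by rw [hconj]; noncomm_ring
        _ = 0 := by rw [hVU, one_mul, hd, mul_zero, zero_mul]
    have hz1 : (d₀ - G t) (U t z) = 0 := by
      rw [hconj, ← mul_apply_eq_comp, mul_assoc, hVU, mul_one,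
        mul_apply_eq_comp, hz, map_zero]
    obtain ⟨w, hw⟩ := exact_of_isUnit_homotopy (↑(d₀ - G t)) (↑h)
      (congrArg ContinuousLinearMap.toLinearMap hdG)
      (hμ'.map ContinuousLinearMap.toLinearMapRingHom) (U t z) hz1
    refine hz' (V t w) ?_
    have hw' : (d₀ - G t) w = U t z := hw
    rw [hconj, mul_apply_eq_comp, mul_apply_eq_comp] at hw'
    have := congrArg (V t) hw'
    rw [← mul_apply_eq_comp, ← mul_apply_eq_comp, hVU] at this
    rw [one_mul, ← mul_apply_eq_comp (V t), hVU] at this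
    exact this
  have hconst : F = fun _ => F 0 := funext fun t =>
    Differentiable.apply_eq_apply_of_bounded (fun t => (hFderiv t).differentiableAt) hbdd t 0
  have h0 := hFderiv 0
  rw [hconst] at h0
  have h1 := h0.unique (hasDerivAt_const (0 : ℂ) (F 0))
  have hU0 : U 0 = 1 := by simp [U]
  have hV0 : V 0 = 1 := by simp [V]
  rw [hU0, hV0] at h1
  rw [← h1]
  noncomm_ring

end Rigidity

/-! ### Contractions and acyclicity -/

section Contraction

variable {k L M : Type*} [CommRing k] [LieRing L] [LieAlgebra k L] [AddCommGroup M] [Module k M]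

/-- The contraction of the complex with a linear form on `L`. -/
def contractOp (g : Module.Dual k L) :
    M ⊗[k] ExteriorAlgebra k L →ₗ[k] M ⊗[k] ExteriorAlgebra k L :=
  (CliffordAlgebra.contractLeft (Q := (0 : QuadraticForm k L)) g).lTensor M

theorem contractLeft_ι_mul (g : Module.Dual k L) (y : L) (ω : ExteriorAlgebra k L) :
    CliffordAlgebra.contractLeft g (ι k y * ω)
      = g y • ω - ι k y * CliffordAlgebra.contractLeft g ω :=
  CliffordAlgebra.contractLeft_ι_mul g y ω

theorem contractOp_extOp (g : Module.Dual k L) (y : L) (t : M ⊗[k] ExteriorAlgebra k L) :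
    contractOp g (extOp y t) = g y • t - extOp y (contractOp g t) := by
  induction t with
  | zero => simp
  | tmul e ω => simp [contractOp, extOp, contractLeft_ι_mul, TensorProduct.tmul_sub]
  | add s t hs ht => simp only [map_add, hs, ht, smul_add]; abel

/-- Twisting the action by a linear form changes the boundary by the contraction. -/
theorem boundary_eq_sub_contractOp {A A' : L →ₗ[k] Module.End k M} {g : Module.Dual k L}
    (h : ∀ x e, A x e = A' x e - g x • e) (t : M ⊗[k] ExteriorAlgebra k L) :
    boundary A t = boundary A' t - contractOp g t := by
  induction t with
  | zero => simp
  | add s t hs ht => simp only [map_add, hs, ht]; abel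
  | tmul e ω =>
    induction ω using ext_induction with
    | one => simp [boundary_tmul_one, contractOp]
    | smul c ω h => simp only [TensorProduct.tmul_smul, map_smul, h, smul_sub]
    | add ω η h h' => simp only [TensorProduct.tmul_add, map_add, h, h']; abel
    | mul y ω ih =>
      have e1 : contractOp g (e ⊗ₜ[k] (ι k y * ω)) = g y • (e ⊗ₜ[k] ω)
          - (LinearMap.mulLeft k (ι k y)).lTensor M (contractOp g (e ⊗ₜ[k] ω)) := by
        have := contractOp_extOp g y (e ⊗ₜ[k] ω)
        simpa [extOp] using this
      rw [boundary_tmul_ι_mul, boundary_tmul_ι_mul, ih, e1, h, map_sub, TensorProduct.sub_tmul,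
        TensorProduct.smul_tmul']
      abel

/-- The complex `M ⊗ ⋀L` is acyclic: every cycle, of any degree, is a boundary. -/
def IsAcyclic (A : L →ₗ[k] Module.End k M) : Prop :=
  ∀ z, boundary A z = 0 → ∃ w, boundary A w = z

theorem nontrivial_homology_iff (A : L →ₗ[k] Module.End k M) :
    Nontrivial (Homology A) ↔ ¬ IsAcyclic A := by
  rw [Submodule.Quotient.nontrivial_iff, not_iff_not, Submodule.submoduleOf_eq_top]
  exact Iff.rfl

end Contraction

/-! ### The complex of an ideal -/

section Ideal

variable {k L N M : Type*} [CommRing k] [LieRing L] [LieAlgebra k L] [LieRing N] [LieAlgebra k N]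
  [AddCommGroup M] [Module k M]

/-- The map of complexes `M ⊗ ⋀N → M ⊗ ⋀L` given by a homomorphism `φ : N → L`. -/
def inclOp (φ : N →ₗ⁅k⁆ L) : M ⊗[k] ExteriorAlgebra k N →ₗ[k] M ⊗[k] ExteriorAlgebra k L :=
  (ExteriorAlgebra.map (φ : N →ₗ[k] L)).toLinearMap.lTensor M

theorem inclOp_tmul (φ : N →ₗ⁅k⁆ L) (e : M) (ω : ExteriorAlgebra k N) :
    inclOp φ (e ⊗ₜ[k] ω) = e ⊗ₜ ExteriorAlgebra.map (φ : N →ₗ[k] L) ω := rfl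

theorem adExt_map (φ : N →ₗ⁅k⁆ L) (y : N) (ω : ExteriorAlgebra k N) :
    adExt (φ y) (ExteriorAlgebra.map (φ : N →ₗ[k] L) ω)
      = ExteriorAlgebra.map (φ : N →ₗ[k] L) (adExt y ω) := by
  induction ω using ext_induction with
  | one => simp [adExt_one]
  | smul c ω h => simp only [map_smul, h]
  | add ω η h h' => simp only [map_add, h, h']
  | mul z ω h => simp [adExt_ι_mul, h]

theorem inclOp_extOp (φ : N →ₗ⁅k⁆ L) (y : N) (t : M ⊗[k] ExteriorAlgebra k N) :
    inclOp φ (extOp y t) = extOp (φ y) (inclOp φ t) := by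
  induction t with
  | zero => simp
  | tmul e ω => simp [inclOp_tmul, extOp]
  | add s t hs ht => simp only [map_add, hs, ht]

theorem boundary_inclOp (φ : N →ₗ⁅k⁆ L) (A : L →ₗ[k] Module.End k M)
    (t : M ⊗[k] ExteriorAlgebra k N) :
    boundary A (inclOp φ t) = inclOp φ (boundary (A ∘ₗ (φ : N →ₗ[k] L)) t) := by
  induction t with
  | zero => simp
  | add s t hs ht => simp only [map_add, hs, ht]
  | tmul e ω =>
    induction ω using ext_induction with
    | one => simp [boundary_tmul_one, inclOp_tmul]
    | smul c ω h => simp only [TensorProduct.tmul_smul, map_smul, h]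
    | add ω η h h' => simp only [TensorProduct.tmul_add, map_add, h, h']
    | mul y ω h =>
      have h1 := inclOp_extOp φ y (boundary (A ∘ₗ (φ : N →ₗ[k] L)) (e ⊗ₜ[k] ω))
      rw [← h] at h1
      simp only [extOp, inclOp_tmul] at h1
      rw [boundary_tmul_ι_mul, map_sub, map_sub, h1, inclOp_tmul, map_mul,
        ExteriorAlgebra.map_apply_ι, inclOp_tmul, inclOp_tmul, ← adExt_map]
      exact boundary_tmul_ι_mul A e (φ y) _

theorem map_map_of_leftInverse {V W : Type*} [AddCommGroup V] [Module k V] [AddCommGroup W]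
    [Module k W] {f : V →ₗ[k] W} {p : W →ₗ[k] V} (h : ∀ y, p (f y) = y)
    (ω : ExteriorAlgebra k V) : ExteriorAlgebra.map p (ExteriorAlgebra.map f ω) = ω := by
  have : p ∘ₗ f = LinearMap.id := LinearMap.ext h
  rw [← AlgHom.comp_apply, ExteriorAlgebra.map_comp_map, this, ExteriorAlgebra.map_id,
    AlgHom.id_apply]

theorem inclOp_injective {φ : N →ₗ⁅k⁆ L} {p : L →ₗ[k] N} (hp : ∀ y, p (φ y) = y) :
    Function.Injective (inclOp φ : M ⊗[k] ExteriorAlgebra k N →ₗ[k] _) := by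
  refine Function.LeftInverse.injective (g := (ExteriorAlgebra.map p).toLinearMap.lTensor M)
    fun t => ?_
  induction t with
  | zero => simp
  | tmul e ω =>
    rw [inclOp_tmul, LinearMap.lTensor_tmul]
    exact congrArg _ (map_map_of_leftInverse (f := (φ : N →ₗ[k] L)) hp ω)
  | add s t hs ht => simp only [map_add, hs, ht]

theorem inclOp_surjective {φ : N →ₗ⁅k⁆ L} {p : L →ₗ[k] N} (hp : ∀ y, φ (p y) = y) :
    Function.Surjective (inclOp φ : M ⊗[k] ExteriorAlgebra k N →ₗ[k] _) := by
  refine Function.RightInverse.surjective (g := (ExteriorAlgebra.map p).toLinearMap.lTensor M)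
    fun t => ?_
  induction t with
  | zero => simp
  | tmul e ω =>
    rw [LinearMap.lTensor_tmul, inclOp_tmul]
    exact congrArg _ (map_map_of_leftInverse (p := (φ : N →ₗ[k] L)) hp ω)
  | add s t hs ht => simp only [map_add, hs, ht]

theorem isAcyclic_comp_iff_of_inverse {φ : N →ₗ⁅k⁆ L} {p : L →ₗ[k] N} (hp : ∀ y, p (φ y) = y)
    (hp' : ∀ y, φ (p y) = y) (A : L →ₗ[k] Module.End k M) :
    IsAcyclic (A ∘ₗ (φ : N →ₗ[k] L)) ↔ IsAcyclic A := by
  have hi := inclOp_injective (M := M) hp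
  have hs := inclOp_surjective (M := M) hp'
  constructor
  · intro h z hz
    obtain ⟨z, rfl⟩ := hs z
    rw [boundary_inclOp] at hz
    obtain ⟨w, rfl⟩ := h z (hi (by rw [hz, map_zero]))
    exact ⟨_, boundary_inclOp φ A w⟩
  · intro h z hz
    obtain ⟨w, hw⟩ := h (inclOp φ z) (by rw [boundary_inclOp, hz, map_zero])
    obtain ⟨w, rfl⟩ := hs w
    rw [boundary_inclOp] at hw
    exact ⟨w, hi hw⟩

/-- For `x : L` and an ideal `φ : N → L` with a linear retraction `p`, the derivation of `⋀N` that
extends the restriction of `ad x` to `N`. It is the conjugate of `adExt x`, which maps the image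
of `⋀N` to itself (see `map_idealAd`), so that the choice of `p` does not matter. -/
def idealAd (φ : N →ₗ⁅k⁆ L) (p : L →ₗ[k] N) (x : L) :
    ExteriorAlgebra k N →ₗ[k] ExteriorAlgebra k N :=
  (ExteriorAlgebra.map p).toLinearMap ∘ₗ adExt x ∘ₗ
    (ExteriorAlgebra.map (φ : N →ₗ[k] L)).toLinearMap

/-- The action of `x : L` on the complex of the ideal `φ : N → L`, see `idealAd`. -/
def idealOp (φ : N →ₗ⁅k⁆ L) (p : L →ₗ[k] N) (A : L →ₗ[k] Module.End k M) (x : L) :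
    M ⊗[k] ExteriorAlgebra k N →ₗ[k] M ⊗[k] ExteriorAlgebra k N :=
  (A x).rTensor _ - (idealAd φ p x).lTensor M

variable {φ : N →ₗ⁅k⁆ L} {p : L →ₗ[k] N} {x : L}

theorem idealAd_one : idealAd φ p x 1 = 0 := by simp [idealAd, adExt_one]

theorem idealAd_ι_mul (hp : ∀ y, p (φ y) = y) (y : N) (ω : ExteriorAlgebra k N) :
    idealAd φ p x (ι k y * ω) = ι k (p ⁅x, φ y⁆) * ω + ι k y * idealAd φ p x ω := by
  have := map_map_of_leftInverse (f := (φ : N →ₗ[k] L)) hp ω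
  simp [idealAd, adExt_ι_mul, hp, this]

theorem map_idealAd (hp : ∀ y, p (φ y) = y) (hI : ∀ y, φ (p ⁅x, φ y⁆) = ⁅x, φ y⁆)
    (ω : ExteriorAlgebra k N) :
    ExteriorAlgebra.map (φ : N →ₗ[k] L) (idealAd φ p x ω)
      = adExt x (ExteriorAlgebra.map (φ : N →ₗ[k] L) ω) := by
  induction ω using ext_induction with
  | one => simp [adExt_one, idealAd_one]
  | smul c ω h => simp only [map_smul, h]
  | add ω η h h' => simp only [map_add, h, h']
  | mul y ω h => simp [idealAd_ι_mul hp, adExt_ι_mul, hI, h]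

theorem inclOp_idealOp (hp : ∀ y, p (φ y) = y) (hI : ∀ y, φ (p ⁅x, φ y⁆) = ⁅x, φ y⁆)
    (A : L →ₗ[k] Module.End k M) (t : M ⊗[k] ExteriorAlgebra k N) :
    inclOp φ (idealOp φ p A x t) = lieOp A x (inclOp φ t) := by
  induction t with
  | zero => simp
  | tmul e ω => simp [idealOp, lieOp, inclOp_tmul, map_idealAd hp hI]
  | add s t hs ht => simp only [map_add, hs, ht]

theorem idealOp_boundary (hp : ∀ y, p (φ y) = y) (hI : ∀ y, φ (p ⁅x, φ y⁆) = ⁅x, φ y⁆)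
    (A : L →ₗ[k] Module.End k M) (hA : ∀ x y e, A ⁅x, y⁆ e = A y (A x e) - A x (A y e))
    (t : M ⊗[k] ExteriorAlgebra k N) :
    boundary (A ∘ₗ (φ : N →ₗ[k] L)) (idealOp φ p A x t)
      = idealOp φ p A x (boundary (A ∘ₗ (φ : N →ₗ[k] L)) t) := by
  apply inclOp_injective hp
  rw [← boundary_inclOp, inclOp_idealOp hp hI, inclOp_idealOp hp hI, boundary_lieOp A hA,
    boundary_inclOp]

/-- The commutator of the action of `x` with the contraction by `g` is the contraction by
`g ∘ ad x`. -/
theorem idealOp_contractOp (hp : ∀ y, p (φ y) = y) (A : L →ₗ[k] Module.End k M)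
    {g g' : Module.Dual k N} (hg : ∀ y, g' y = g (p ⁅x, φ y⁆)) (t : M ⊗[k] ExteriorAlgebra k N) :
    idealOp φ p A x (contractOp g t) - contractOp g (idealOp φ p A x t) = contractOp g' t := by
  have key (ω : ExteriorAlgebra k N) :
      CliffordAlgebra.contractLeft g (idealAd φ p x ω)
        = idealAd φ p x (CliffordAlgebra.contractLeft g ω)
          + CliffordAlgebra.contractLeft g' ω := by
    induction ω using ext_induction with
    | one => simp [idealAd_one]
    | smul c ω h => simp only [map_smul, h, smul_add]
    | add ω η h h' => simp only [map_add, h, h']; abel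
    | mul y ω h =>
      simp only [idealAd_ι_mul hp, contractLeft_ι_mul, map_add, map_sub, map_smul, h, hg, mul_add]
      abel
  induction t with
  | zero => simp
  | tmul e ω => simp [idealOp, contractOp, key, TensorProduct.tmul_add]
  | add s t hs ht =>
    rw [map_add, map_add, map_add, map_add, map_add, ← hs, ← ht]
    abel

end Ideal

/-! ### The complex of `L = N ⊕ k x` as a mapping cone -/

section Hyperplane

variable {k L N M : Type*} [CommRing k] [LieRing L] [LieAlgebra k L] [LieRing N] [LieAlgebra k N]
  [AddCommGroup M] [Module k M] {φ : N →ₗ⁅k⁆ L} {p : L →ₗ[k] N} {x : L} {ξ : Module.Dual k L}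

theorem contractOp_inclOp (hξ : ∀ y, ξ (φ y) = 0) (t : M ⊗[k] ExteriorAlgebra k N) :
    contractOp ξ (inclOp φ t) = 0 := by
  induction t with
  | zero => simp
  | add s t hs ht => rw [map_add, map_add, hs, ht, add_zero]
  | tmul e ω =>
    have key (ω : ExteriorAlgebra k N) :
        CliffordAlgebra.contractLeft ξ (ExteriorAlgebra.map (φ : N →ₗ[k] L) ω) = 0 := by
      induction ω using ext_induction with
      | one => simp
      | smul c ω h => rw [map_smul, map_smul, h, smul_zero]
      | add ω η h h' => rw [map_add, map_add, h, h', add_zero]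
      | mul y ω h => simp [contractLeft_ι_mul, h, hξ]
    simp [inclOp_tmul, contractOp, key]

/-- If `L = N ⊕ k x`, then `M ⊗ ⋀L` is the sum of `M ⊗ ⋀N` and `x ∧ (M ⊗ ⋀N)`. -/
theorem exists_eq_inclOp_add (hφp : ∀ y, φ (p y) = y - ξ y • x) (t : M ⊗[k] ExteriorAlgebra k L) :
    ∃ b a : M ⊗[k] ExteriorAlgebra k N, t = inclOp φ b + extOp x (inclOp φ a) := by
  induction t with
  | zero => exact ⟨0, 0, by simp⟩
  | add s t hs ht =>
    obtain ⟨b, a, rfl⟩ := hs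
    obtain ⟨b', a', rfl⟩ := ht
    refine ⟨b + b', a + a', ?_⟩
    simp only [map_add]
    abel
  | tmul e ω =>
    have key : ∃ β α : ExteriorAlgebra k N, ω = ExteriorAlgebra.map (φ : N →ₗ[k] L) β
        + ι k x * ExteriorAlgebra.map (φ : N →ₗ[k] L) α := by
      induction ω using ext_induction with
      | one => exact ⟨1, 0, by simp⟩
      | smul c ω h =>
        obtain ⟨β, α, rfl⟩ := h
        exact ⟨c • β, c • α, by simp⟩
      | add ω η h h' =>
        obtain ⟨β, α, rfl⟩ := h
        obtain ⟨β', α', rfl⟩ := h'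
        refine ⟨β + β', α + α', ?_⟩
        simp only [map_add, mul_add]
        abel
      | mul y ω h =>
        obtain ⟨β, α, rfl⟩ := h
        refine ⟨ι k (p y) * β, ξ y • β - ι k (p y) * α, ?_⟩
        have hc : ι k y * (ι k x * ExteriorAlgebra.map (φ : N →ₗ[k] L) α)
            = - (ι k x * (ι k y * ExteriorAlgebra.map (φ : N →ₗ[k] L) α)) := by
          rw [← mul_assoc, ← mul_assoc, ← neg_mul,
            eq_neg_of_add_eq_zero_left (ι_add_mul_swap y x)]
        have hx : ι k x * (ι k x * ExteriorAlgebra.map (φ : N →ₗ[k] L) α) = 0 := by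
          rw [← mul_assoc, ι_sq_zero, zero_mul]
        simp [hφp, mul_add, sub_mul, mul_sub, hc, hx]
        abel
    obtain ⟨β, α, rfl⟩ := key
    exact ⟨e ⊗ₜ β, e ⊗ₜ α, by simp [inclOp_tmul, extOp, TensorProduct.tmul_add]⟩

theorem eq_zero_of_inclOp_add_eq_zero (hp : ∀ y, p (φ y) = y) (hξ : ∀ y, ξ (φ y) = 0)
    (hξx : ξ x = 1) {b a : M ⊗[k] ExteriorAlgebra k N}
    (h : inclOp φ b + extOp x (inclOp φ a) = 0) : b = 0 ∧ a = 0 := by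
  have hi := inclOp_injective (M := M) hp
  have h1 := congrArg (contractOp ξ) h
  rw [map_add, contractOp_inclOp hξ, contractOp_extOp, contractOp_inclOp hξ, hξx, one_smul,
    map_zero, map_zero, sub_zero, zero_add] at h1
  rw [h1, map_zero, add_zero] at h
  exact ⟨hi (by rw [h, map_zero]), hi (by rw [h1, map_zero])⟩

theorem boundary_inclOp_add (hp : ∀ y, p (φ y) = y) (hI : ∀ y, φ (p ⁅x, φ y⁆) = ⁅x, φ y⁆)
    (A : L →ₗ[k] Module.End k M) (b a : M ⊗[k] ExteriorAlgebra k N) :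
    boundary A (inclOp φ b + extOp x (inclOp φ a))
      = inclOp φ (boundary (A ∘ₗ (φ : N →ₗ[k] L)) b + idealOp φ p A x a)
        + extOp x (inclOp φ (- boundary (A ∘ₗ (φ : N →ₗ[k] L)) a)) := by
  rw [map_add, boundary_extOp, boundary_inclOp, boundary_inclOp, ← inclOp_idealOp hp hI, map_add,
    map_neg, map_neg]
  abel

/-- The complex of `L = N ⊕ k x` is the mapping cone of the action of `x` on the complex of `N`: if
the former is acyclic, then the cone is exact. -/
theorem IsAcyclic.cone (hp : ∀ y, p (φ y) = y) (hI : ∀ y, φ (p ⁅x, φ y⁆) = ⁅x, φ y⁆)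
    (hφp : ∀ y, φ (p y) = y - ξ y • x) (hξ : ∀ y, ξ (φ y) = 0) (hξx : ξ x = 1)
    {A : L →ₗ[k] Module.End k M} (hA : IsAcyclic A) {a b : M ⊗[k] ExteriorAlgebra k N}
    (ha : boundary (A ∘ₗ (φ : N →ₗ[k] L)) a = 0)
    (hab : idealOp φ p A x a = boundary (A ∘ₗ (φ : N →ₗ[k] L)) b) :
    ∃ a' b', boundary (A ∘ₗ (φ : N →ₗ[k] L)) a' = a ∧
      idealOp φ p A x a' - boundary (A ∘ₗ (φ : N →ₗ[k] L)) b' = b := by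
  obtain ⟨w, hw⟩ := hA (inclOp φ (-b) + extOp x (inclOp φ a)) (by
    rw [boundary_inclOp_add hp hI, ha, hab]
    simp)
  obtain ⟨b', a', rfl⟩ := exists_eq_inclOp_add hφp w
  rw [boundary_inclOp_add hp hI, ← sub_eq_zero, add_sub_add_comm, ← map_sub, ← map_sub,
    ← map_sub] at hw
  obtain ⟨h1, h2⟩ := eq_zero_of_inclOp_add_eq_zero hp hξ hξx hw
  refine ⟨-a', b', ?_, ?_⟩
  · rw [map_neg]
    exact sub_eq_zero.1 h2
  · rw [map_neg]
    rw [sub_neg_eq_add] at h1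
    rw [← sub_eq_zero, ← neg_eq_zero, ← h1]
    abel

/-- If the complex of the ideal `N` is acyclic, then so is the complex of `L = N ⊕ k x`. -/
theorem IsAcyclic.of_comp (hp : ∀ y, p (φ y) = y) (hI : ∀ y, φ (p ⁅x, φ y⁆) = ⁅x, φ y⁆)
    (hφp : ∀ y, φ (p y) = y - ξ y • x) (hξ : ∀ y, ξ (φ y) = 0) (hξx : ξ x = 1)
    {A : L →ₗ[k] Module.End k M} (hA : ∀ x y e, A ⁅x, y⁆ e = A y (A x e) - A x (A y e))
    (h : IsAcyclic (A ∘ₗ (φ : N →ₗ[k] L))) : IsAcyclic A := by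
  intro z hz
  obtain ⟨b, a, rfl⟩ := exists_eq_inclOp_add hφp z
  rw [boundary_inclOp_add hp hI] at hz
  obtain ⟨h1, h2⟩ := eq_zero_of_inclOp_add_eq_zero hp hξ hξx hz
  obtain ⟨a', ha'⟩ := h a (neg_eq_zero.1 h2)
  obtain ⟨b', hb'⟩ := h (b + idealOp φ p A x a') (by
    rw [map_add, idealOp_boundary hp hI A hA, ha', h1])
  refine ⟨inclOp φ b' + extOp x (inclOp φ (-a')), ?_⟩
  rw [boundary_inclOp_add hp hI, map_neg (idealOp φ p A x), map_neg (boundary _), neg_neg, ha', hb', add_neg_cancel_right]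

end Hyperplane

/-! ### The Banach space `E ⊗ W` for finite-dimensional `W` -/

section Norm

theorem finiteDimensional_exteriorAlgebra (V : Type*) [AddCommGroup V] [Module ℂ V]
    [FiniteDimensional ℂ V] : FiniteDimensional ℂ (ExteriorAlgebra ℂ V) :=
  (Module.finBasis ℂ V).ExteriorAlgebra.finiteDimensional_of_finite

variable (E W : Type*) [NormedAddCommGroup E] [NormedSpace ℂ E] [AddCommGroup W] [Module ℂ W]
  [FiniteDimensional ℂ W]

/-- The coordinates of `E ⊗ W` in a basis of the finite-dimensional space `W`. -/
noncomputable def tensorCoord : E ⊗[ℂ] W ≃ₗ[ℂ] (Fin (Module.finrank ℂ W) → E) :=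
  TensorProduct.equivFinsuppOfBasisRight (Module.finBasis ℂ W) ≪≫ₗ
    Finsupp.linearEquivFunOnFinite ℂ E _

/-- The norm on `E ⊗ W`, for finite-dimensional `W`, that is the supremum of the norms of the
coordinates in a basis of `W`. -/
@[reducible] noncomputable def tensorNormedAddCommGroup : NormedAddCommGroup (E ⊗[ℂ] W) :=
  NormedAddCommGroup.induced _ _ (tensorCoord E W) (tensorCoord E W).injective

attribute [local instance] tensorNormedAddCommGroup

/-- The normed space structure that goes with `tensorNormedAddCommGroup`. -/
@[reducible] noncomputable def tensorNormedSpace : NormedSpace ℂ (E ⊗[ℂ] W) :=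
  NormedSpace.induced ℂ _ _ (tensorCoord E W)

attribute [local instance] tensorNormedSpace

theorem isometry_tensorCoord : Isometry (tensorCoord E W) :=
  AddMonoidHomClass.isometry_of_norm _ fun _ => rfl

theorem completeSpace_tensor [CompleteSpace E] : CompleteSpace (E ⊗[ℂ] W) :=
  (completeSpace_congr (e := (tensorCoord E W).toEquiv)
    (isometry_tensorCoord E W).isUniformEmbedding).2 inferInstance

variable {E W}

theorem tensorCoord_tmul (e : E) (w : W) (i : Fin (Module.finrank ℂ W)) :
    tensorCoord E W (e ⊗ₜ w) i = (Module.finBasis ℂ W).repr w i • e :=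
  TensorProduct.equivFinsuppOfBasisRight_apply_tmul_apply _ e w i

theorem tensorCoord_symm (v : Fin (Module.finrank ℂ W) → E) :
    (tensorCoord E W).symm v = ∑ i, v i ⊗ₜ Module.finBasis ℂ W i := by
  rw [LinearEquiv.symm_apply_eq]
  ext j
  simp [tensorCoord_tmul, Finsupp.single_apply]

theorem continuous_tmul_const (w : W) : Continuous fun e : E => e ⊗ₜ[ℂ] w := by
  rw [(isometry_tensorCoord E W).isEmbedding.continuous_iff]
  refine continuous_pi fun i => ?_
  simp only [Function.comp_apply, tensorCoord_tmul]
  fun_prop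

/-- A linear map on `E ⊗ W` is continuous if it is so on each of the subspaces `E ⊗ w`. -/
theorem continuous_of_continuous_tmul {F : Type*} [AddCommGroup F] [Module ℂ F]
    [TopologicalSpace F] [ContinuousAdd F] (T : E ⊗[ℂ] W →ₗ[ℂ] F)
    (h : ∀ w, Continuous fun e => T (e ⊗ₜ w)) : Continuous T := by
  have e1 : (T : E ⊗[ℂ] W → F)
      = fun t => ∑ i, T (tensorCoord E W t i ⊗ₜ Module.finBasis ℂ W i) := by
    funext t
    rw [← map_sum, ← tensorCoord_symm, LinearEquiv.symm_apply_apply]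
  rw [e1]
  refine continuous_finsetSum _ fun i _ => (h _).comp ?_
  exact (continuous_apply i).comp (isometry_tensorCoord E W).continuous

theorem continuous_lTensor (T : W →ₗ[ℂ] W) : Continuous (T.lTensor E) :=
  continuous_of_continuous_tmul _ fun w => continuous_tmul_const (T w)

theorem continuous_rTensor (T : E →ₗ[ℂ] E) (hT : Continuous T) : Continuous (T.rTensor W) :=
  continuous_of_continuous_tmul _ fun w => (continuous_tmul_const w).comp hT

end Norm

/-! ### The projection property -/

section Step

attribute [local instance] tensorNormedAddCommGroup tensorNormedSpace
  finiteDimensional_exteriorAlgebra completeSpace_tensor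

variable {L N E : Type*} [LieRing L] [LieAlgebra ℂ L] [LieRing N] [LieAlgebra ℂ N]
  [NormedAddCommGroup E] [NormedSpace ℂ E]

theorem continuous_boundary [FiniteDimensional ℂ N] (A : N →ₗ[ℂ] Module.End ℂ E)
    (hA : ∀ x, Continuous (A x)) : Continuous (boundary A) := by
  refine continuous_of_continuous_tmul _ fun ω => ?_
  induction ω using ext_induction with
  | one => simpa only [boundary_tmul_one] using continuous_const
  | smul c ω h =>
    simp only [TensorProduct.tmul_smul, map_smul]
    exact h.fun_const_smul c
  | add ω η h h' =>
    simp only [TensorProduct.tmul_add, map_add]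
    exact h.fun_add h'
  | mul y ω h =>
    simp only [boundary_tmul_ι_mul]
    exact (((continuous_tmul_const ω).comp (hA y)).sub (continuous_tmul_const _)).sub
      ((continuous_lTensor _).comp h)

theorem continuous_shiftedAction (ρ : N →ₗ⁅ℂ⁆ (E →L[ℂ] E)ᵐᵒᵖ) (f : Module.Dual ℂ N) (x : N) :
    Continuous (shiftedAction ρ f x) := by
  change Continuous fun e => (ρ x).unop e - f x • e
  fun_prop

theorem shiftedAction_comp (ρ : L →ₗ⁅ℂ⁆ (E →L[ℂ] E)ᵐᵒᵖ) (f : Module.Dual ℂ L)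
    (φ : N →ₗ⁅ℂ⁆ L) : shiftedAction ρ f ∘ₗ (φ : N →ₗ[ℂ] L)
      = shiftedAction (ρ.comp φ) (f ∘ₗ (φ : N →ₗ[ℂ] L)) := rfl

theorem mem_jointSpectrum_iff (ρ : L →ₗ⁅ℂ⁆ (E →L[ℂ] E)ᵐᵒᵖ) (f : Module.Dual ℂ L) :
    f ∈ jointSpectrum ρ ↔ (∀ x y : L, f ⁅x, y⁆ = 0) ∧ ¬ IsAcyclic (shiftedAction ρ f) := by
  rw [← nontrivial_homology_iff]
  rfl

variable {φ : N →ₗ⁅ℂ⁆ L} {p : L →ₗ[ℂ] N} {x : L} {ξ : Module.Dual ℂ L}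

/-- The characters in the joint spectrum of an ideal `φ : N → L` vanish on `[L, N]`. The action `Θ` of
`x : L` on the complex of `N` satisfies `[Θ, c_g] = c_{g ∘ ad x}` for the contractions `c_g`, and the
anticommutator of `c_g` with the multiplication by `y` is the scalar `g y`, so that
`anticommutator_commutator_eq_zero` applies. -/
theorem apply_lie_eq_zero_of_mem_jointSpectrum [FiniteDimensional ℂ N] [CompleteSpace E]
    (ρ : L →ₗ⁅ℂ⁆ (E →L[ℂ] E)ᵐᵒᵖ) (hp : ∀ y, p (φ y) = y)
    (hI : ∀ y, φ (p ⁅x, φ y⁆) = ⁅x, φ y⁆) {f : Module.Dual ℂ N}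
    (hf : f ∈ jointSpectrum (ρ.comp φ)) (y : N) : f (p ⁅x, φ y⁆) = 0 := by
  obtain ⟨hf, hne⟩ := (mem_jointSpectrum_iff _ _).1 hf
  have hfA (x : N) (e : E) : shiftedAction (ρ.comp φ) f x e
      = shiftedAction (ρ.comp φ) 0 x e - f x • e := by simp [shiftedAction]
  let K := E ⊗[ℂ] ExteriorAlgebra ℂ N
  let d₀ : K →L[ℂ] K := ⟨boundary (shiftedAction (ρ.comp φ) 0),
    continuous_boundary _ (continuous_shiftedAction _ _)⟩
  let Θ : K →L[ℂ] K := ⟨idealOp φ p (shiftedAction ρ 0) x,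
    (continuous_rTensor _ (continuous_shiftedAction ρ 0 x)).sub (continuous_lTensor _)⟩
  let h : K →L[ℂ] K := ⟨extOp y, continuous_lTensor _⟩
  let c : Module.Dual ℂ N →ₗ[ℂ] (K →L[ℂ] K) :=
    { toFun := fun g => ⟨contractOp g, continuous_lTensor _⟩
      map_add' := fun g g' => by
        ext1 t
        simp [contractOp, LinearMap.lTensor_add]
      map_smul' := fun a g => by
        ext1 t
        simp [contractOp, LinearMap.lTensor_smul] }
  have hc (g : Module.Dual ℂ N) (t : K) : c g t = contractOp g t := rfl
  let δ : Module.Dual ℂ N →ₗ[ℂ] Module.Dual ℂ N :=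
    Module.Dual.transpose (p ∘ₗ (LieAlgebra.ad ℂ L x : L →ₗ[ℂ] L) ∘ₗ (φ : N →ₗ[ℂ] L))
  have hδ (g : Module.Dual ℂ N) (y : N) : δ g y = g (p ⁅x, φ y⁆) := rfl
  have hΘc (g : Module.Dual ℂ N) : Θ * c g - c g * Θ = c (δ g) := by
    ext1 t
    exact idealOp_contractOp hp (shiftedAction ρ 0) (hδ g) t
  have hch (g : Module.Dual ℂ N) : c g * h + h * c g = g y • 1 := by
    ext1 t
    change contractOp g (extOp y t) + extOp y (contractOp g t) = g y • t
    rw [contractOp_extOp, sub_add_cancel]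
  have hd (t : K) : (d₀ - c f) t = boundary (shiftedAction (ρ.comp φ) f) t :=
    (boundary_eq_sub_contractOp hfA t).symm
  have hsq : (d₀ - c f) * (d₀ - c f) = 0 := by
    ext1 t
    rw [mul_apply_eq_comp, hd, hd]
    exact LinearMap.congr_fun (boundary_comp_boundary _ (shiftedAction_lie _ f hf)) t
  have hΘd : Θ * d₀ = d₀ * Θ := by
    ext1 t
    exact (idealOp_boundary hp hI (shiftedAction ρ 0)
      (shiftedAction_lie ρ 0 fun _ _ => rfl) t).symm
  unfold IsAcyclic at hne
  push Not at hne
  obtain ⟨z, hz, hz'⟩ := hne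
  have key := anticommutator_commutator_eq_zero d₀ Θ h (LinearMap.range c)
    (by
      rintro _ ⟨g, rfl⟩
      exact ⟨δ g, (hΘc g).symm⟩) hΘd
    (by
      rintro _ ⟨g, rfl⟩
      exact ⟨g y, hch g⟩) (c f) ⟨f, rfl⟩ hsq z ((hd z).trans hz)
    fun w hw => hz' w ((hd w).symm.trans hw)
  rw [hΘc, hch] at key
  have h1 : δ f y • z = 0 := DFunLike.congr_fun key z
  have hz0 : z ≠ 0 := fun h0 => hz' 0 (by rw [map_zero, h0])
  exact (smul_eq_zero.1 h1).resolve_right hz0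

/-- A character in the joint spectrum of `N` extends to one in the joint spectrum of
`L = N ⊕ ℂ x`: a spectral value of `x` on the homology of `N` gives the value at `x`. -/
theorem exists_mem_jointSpectrum_extend [FiniteDimensional ℂ N] [CompleteSpace E]
    (ρ : L →ₗ⁅ℂ⁆ (E →L[ℂ] E)ᵐᵒᵖ) (hp : ∀ y, p (φ y) = y)
    (hI : ∀ y, φ (p ⁅x, φ y⁆) = ⁅x, φ y⁆) (hφp : ∀ y, φ (p y) = y - ξ y • x)
    (hξ : ∀ y, ξ (φ y) = 0) (hξx : ξ x = 1) {f : Module.Dual ℂ N}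
    (hf : f ∈ jointSpectrum (ρ.comp φ)) :
    ∃ f' ∈ jointSpectrum ρ, f' ∘ₗ (φ : N →ₗ[ℂ] L) = f := by
  have hfx := apply_lie_eq_zero_of_mem_jointSpectrum ρ hp hI hf
  obtain ⟨hf, hne⟩ := (mem_jointSpectrum_iff _ _).1 hf
  have hpx : p x = 0 := by
    have h1 : φ (p x) = φ 0 := by rw [hφp, hξx, one_smul, sub_self, map_zero]
    rw [← hp (p x), h1, hp]
  -- `F c` is the extension of `f` with value `c` at `x`, a character since `f` vanishes on `[x, N]`.
  let F (c : ℂ) : Module.Dual ℂ L := f ∘ₗ p + c • ξ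
  have hFφ (c : ℂ) : F c ∘ₗ (φ : N →ₗ[ℂ] L) = f := by
    ext y
    simp [F, hp, hξ]
  have hFx (c : ℂ) : F c x = c := by simp [F, hpx, hξx]
  have hFlie (c : ℂ) (u v : L) : F c ⁅u, v⁆ = 0 := by
    have hdec (u : L) : u = φ (p u) + ξ u • x := by rw [hφp, sub_add_cancel]
    have h1 (y : N) : F c ⁅x, φ y⁆ = 0 := by
      rw [← hI]
      exact (LinearMap.congr_fun (hFφ c) _).trans (hfx y)
    have h2 (y : N) : F c ⁅φ y, x⁆ = 0 := by rw [← lie_skew, map_neg, h1, neg_zero]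
    have h3 (y y' : N) : F c ⁅φ y, φ y'⁆ = 0 := by
      rw [← LieHom.map_lie]
      exact (LinearMap.congr_fun (hFφ c) _).trans (hf y y')
    rw [hdec u, hdec v]
    simp [h1, h2, h3]
  by_contra hcon
  push Not at hcon
  have hacyc (c : ℂ) : IsAcyclic (shiftedAction ρ (F c)) := by
    by_contra h
    exact hcon (F c) ((mem_jointSpectrum_iff _ _).2 ⟨hFlie c, h⟩) (hFφ c)
  refine hne ?_
  have hcomp (c : ℂ) : shiftedAction ρ (F c) ∘ₗ (φ : N →ₗ[ℂ] L)
      = shiftedAction (ρ.comp φ) f := by rw [shiftedAction_comp, hFφ]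
  -- The complexes of the `F c` are the cones of `T - c` for a single operator `T`, all of them exact.
  have hop (c : ℂ) (t : E ⊗[ℂ] ExteriorAlgebra ℂ N) :
      idealOp φ p (shiftedAction ρ (F c)) x t
        = idealOp φ p (shiftedAction ρ (F 0)) x t - c • t := by
    have : shiftedAction ρ (F c) x = shiftedAction ρ (F 0) x - c • LinearMap.id := by
      ext e
      simp [shiftedAction, hFx]
    simp only [idealOp, this, LinearMap.sub_apply, LinearMap.rTensor_sub, LinearMap.rTensor_smul,
      LinearMap.rTensor_id, LinearMap.smul_apply, LinearMap.id_apply]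
    abel
  let K := E ⊗[ℂ] ExteriorAlgebra ℂ N
  let d : K →L[ℂ] K := ⟨boundary (shiftedAction (ρ.comp φ) f),
    continuous_boundary _ (continuous_shiftedAction _ _)⟩
  let T : K →L[ℂ] K := ⟨idealOp φ p (shiftedAction ρ (F 0)) x,
    (continuous_rTensor _ (continuous_shiftedAction ρ _ x)).sub (continuous_lTensor _)⟩
  refine exact_of_cone_exact d T
    (LinearMap.congr_fun (boundary_comp_boundary _ (shiftedAction_lie _ f hf))) (fun t => ?_) ?_
  · have := idealOp_boundary hp hI (shiftedAction ρ (F 0)) (shiftedAction_lie ρ _ (hFlie 0)) t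
    rwa [hcomp] at this
  · intro c a b ha hab
    have := (hacyc c).cone hp hI hφp hξ hξx (a := a) (b := b)
    rw [hcomp, hop] at this
    obtain ⟨a', b', h1, h2⟩ := this ha hab
    rw [hop] at h2
    exact ⟨a', b', h1, h2⟩

/-- Restriction to a hyperplane ideal maps the joint spectrum to the joint spectrum. -/
theorem comp_mem_jointSpectrum (ρ : L →ₗ⁅ℂ⁆ (E →L[ℂ] E)ᵐᵒᵖ) (hp : ∀ y, p (φ y) = y)
    (hI : ∀ y, φ (p ⁅x, φ y⁆) = ⁅x, φ y⁆) (hφp : ∀ y, φ (p y) = y - ξ y • x)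
    (hξ : ∀ y, ξ (φ y) = 0) (hξx : ξ x = 1) {f : Module.Dual ℂ L} (hf : f ∈ jointSpectrum ρ) :
    f ∘ₗ (φ : N →ₗ[ℂ] L) ∈ jointSpectrum (ρ.comp φ) := by
  obtain ⟨hf, hne⟩ := (mem_jointSpectrum_iff _ _).1 hf
  refine (mem_jointSpectrum_iff _ _).2 ⟨fun u v => ?_, fun h => hne ?_⟩
  · change f (φ ⁅u, v⁆) = 0
    rw [LieHom.map_lie, hf]
  · exact IsAcyclic.of_comp hp hI hφp hξ hξx (shiftedAction_lie ρ f hf) h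

/-- The projection property for an ideal `φ : N → L` that is the kernel of a linear form. -/
theorem jointSpectrum_comp_of_hyperplane [FiniteDimensional ℂ N] [CompleteSpace E]
    (ρ : L →ₗ⁅ℂ⁆ (E →L[ℂ] E)ᵐᵒᵖ) (hφ : Function.Injective φ)
    (hI : ∀ (x : L) y, ∃ y', φ y' = ⁅x, φ y⁆) (ξ : Module.Dual ℂ L) (hξ0 : ξ ≠ 0)
    (hξ : ∀ y, ξ y = 0 ↔ ∃ y', φ y' = y) :
    jointSpectrum (ρ.comp φ) = (fun f => f ∘ₗ (φ : N →ₗ[ℂ] L)) '' jointSpectrum ρ := by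
  obtain ⟨x₀, hx₀⟩ : ∃ x, ξ x ≠ 0 := by
    by_contra! h
    exact hξ0 (LinearMap.ext h)
  obtain ⟨x, hx⟩ : ∃ x, ξ x = 1 := ⟨(ξ x₀)⁻¹ • x₀, by simp [hx₀]⟩
  obtain ⟨q, hq⟩ := LinearMap.exists_leftInverse_of_injective (φ : N →ₗ[ℂ] L)
    (LinearMap.ker_eq_bot.2 hφ)
  have hq' (y : N) : q (φ y) = y := LinearMap.congr_fun hq y
  let p : L →ₗ[ℂ] N := q ∘ₗ (LinearMap.id - ξ.smulRight x)
  have hpy (y : L) : p y = q (y - ξ y • x) := rfl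
  have hξφ (y : N) : ξ (φ y) = 0 := (hξ _).2 ⟨y, rfl⟩
  have hp (y : N) : p (φ y) = y := by rw [hpy, hξφ, zero_smul, sub_zero, hq']
  have hφp (y : L) : φ (p y) = y - ξ y • x := by
    obtain ⟨y', hy'⟩ := (hξ (y - ξ y • x)).1 (by simp [hx])
    rw [hpy, ← hy', hq']
  have hI' (y : N) : φ (p ⁅x, φ y⁆) = ⁅x, φ y⁆ := by
    obtain ⟨y', hy'⟩ := hI x y
    rw [← hy', hp]
  ext f
  constructor
  · exact exists_mem_jointSpectrum_extend ρ hp hI' hφp hξφ hx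
  · rintro ⟨f, hf, rfl⟩
    exact comp_mem_jointSpectrum ρ hp hI' hφp hξφ hx hf

theorem jointSpectrum_comp_of_bijective (ρ : L →ₗ⁅ℂ⁆ (E →L[ℂ] E)ᵐᵒᵖ)
    (hφ : Function.Bijective φ) :
    jointSpectrum (ρ.comp φ) = (fun f => f ∘ₗ (φ : N →ₗ[ℂ] L)) '' jointSpectrum ρ := by
  let e : N ≃ₗ[ℂ] L := LinearEquiv.ofBijective (φ : N →ₗ[ℂ] L) hφ
  have he (y : N) : e.symm (φ y) = y := e.symm_apply_apply y
  have he' (y : L) : φ (e.symm y) = y := e.apply_symm_apply y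
  have key (f : Module.Dual ℂ L) :
      f ∘ₗ (φ : N →ₗ[ℂ] L) ∈ jointSpectrum (ρ.comp φ) ↔ f ∈ jointSpectrum ρ := by
    rw [mem_jointSpectrum_iff, mem_jointSpectrum_iff, ← shiftedAction_comp,
      isAcyclic_comp_iff_of_inverse (p := (e.symm : L →ₗ[ℂ] N)) he he']
    refine and_congr_left fun _ => ⟨fun h u v => ?_, fun h u v => ?_⟩
    · have := h (e.symm u) (e.symm v)
      rwa [LinearMap.comp_apply, LieHom.coe_toLinearMap, LieHom.map_lie, he', he'] at this
    · rw [LinearMap.comp_apply, LieHom.coe_toLinearMap, LieHom.map_lie, h]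
  ext f
  constructor
  · intro hf
    have hfe : (f ∘ₗ (e.symm : L →ₗ[ℂ] N)) ∘ₗ (φ : N →ₗ[ℂ] L) = f := by
      ext y
      simp [he]
    exact ⟨_, (key _).1 (hfe.symm ▸ hf), hfe⟩
  · rintro ⟨f, hf, rfl⟩
    exact (key f).2 hf

/-- A solvable Lie algebra has a character that vanishes on a given proper ideal. -/
theorem exists_character_of_ne_top [LieAlgebra.IsSolvable L] (J : LieIdeal ℂ L) (hJ : J ≠ ⊤) :
    ∃ ξ : Module.Dual ℂ L, ξ ≠ 0 ∧ (∀ u v : L, ξ ⁅u, v⁆ = 0) ∧ ∀ y ∈ J, ξ y = 0 := by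
  -- If `[L, L] + J = L`, then each term of the derived series and `J` span `L`.
  have hlt : (LieAlgebra.derivedSeries ℂ L 1 ⊔ J).toSubmodule < ⊤ := by
    refine lt_top_iff_ne_top.2 fun h => hJ ?_
    rw [LieSubmodule.toSubmodule_eq_top] at h
    have hk (k : ℕ) : LieAlgebra.derivedSeries ℂ L k ⊔ J = ⊤ := by
      induction k with
      | zero => simp [LieAlgebra.derivedSeries_def]
      | succ k ih =>
        have h1 := LieAlgebra.derivedSeriesOfIdeal_add_le_add (R := ℂ)
          (LieAlgebra.derivedSeries ℂ L k) J 1 0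
        rw [LieSubmodule.add_eq_sup, LieSubmodule.add_eq_sup, ih, LieAlgebra.derivedSeries_def,
          ← LieAlgebra.derivedSeriesOfIdeal_add, LieAlgebra.derivedSeriesOfIdeal_zero,
          add_comm 1 k] at h1
        exact top_le_iff.1 (h ▸ sup_le h1 le_sup_right)
    obtain ⟨k, hk0⟩ := LieAlgebra.IsSolvable.solvable ℂ L
    simpa [hk0] using hk k
  obtain ⟨ξ, hξ0, hξ⟩ := Submodule.exists_le_ker_of_lt_top _ hlt
  refine ⟨ξ, hξ0, fun u v => hξ ?_, fun y hy => hξ ?_⟩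
  · refine (LieSubmodule.mem_sup _ _ _).2 ⟨⁅u, v⁆, ?_, 0, J.zero_mem, add_zero _⟩
    rw [LieAlgebra.derivedSeries_def, LieAlgebra.derivedSeriesOfIdeal_succ]
    exact LieSubmodule.lie_mem_lie (LieSubmodule.mem_top u) (LieSubmodule.mem_top v)
  · exact (LieSubmodule.mem_sup _ _ _).2 ⟨0, LieSubmodule.zero_mem _, y, hy, zero_add _⟩

end Step

/-- The projection property for an ideal, given as an injective homomorphism `φ : N → L` with range
an ideal. This form allows an induction through a chain of subalgebras of `L` that contain
the ideal, each a hyperplane in the next. -/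
theorem jointSpectrum_comp {L N E : Type*} [LieRing L] [LieAlgebra ℂ L] [FiniteDimensional ℂ L]
    [LieAlgebra.IsSolvable L] [LieRing N] [LieAlgebra ℂ N] [NormedAddCommGroup E] [NormedSpace ℂ E]
    [CompleteSpace E] (ρ : L →ₗ⁅ℂ⁆ (E →L[ℂ] E)ᵐᵒᵖ) (φ : N →ₗ⁅ℂ⁆ L) (hφ : Function.Injective φ)
    (hI : ∀ (x : L) y, ∃ y', φ y' = ⁅x, φ y⁆) :
    jointSpectrum (ρ.comp φ) = (fun f => f ∘ₗ (φ : N →ₗ[ℂ] L)) '' jointSpectrum ρ := by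
  induction hn : Module.finrank ℂ L using Nat.strong_induction_on generalizing L with
  | _ n ih =>
  by_cases hs : Function.Surjective φ
  · exact jointSpectrum_comp_of_bijective ρ ⟨hφ, hs⟩
  let R : LieIdeal ℂ L :=
    { LinearMap.range (φ : N →ₗ[ℂ] L) with
      lie_mem := by
        rintro x _ ⟨y, rfl⟩
        exact hI x y }
  have hR : R ≠ ⊤ := fun h => hs fun y => by
    have : y ∈ R := h ▸ LieSubmodule.mem_top y
    exact this
  obtain ⟨ξ, hξ0, hξ, hξR⟩ := exists_character_of_ne_top R hR
  have hξφ (y : N) : ξ (φ y) = 0 := hξR _ ⟨y, rfl⟩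
  let J : LieIdeal ℂ L := { LinearMap.ker ξ with lie_mem := fun {x m} _ => hξ x m }
  have hJ (y : L) : y ∈ J ↔ ξ y = 0 := Iff.rfl
  let ψ : N →ₗ⁅ℂ⁆ J :=
    { toFun := fun y => ⟨φ y, hξφ y⟩
      map_add' := fun y y' => Subtype.ext (map_add φ y y')
      map_smul' := fun c y => Subtype.ext (map_smul φ c y)
      map_lie' := fun {y y'} => Subtype.ext (φ.map_lie y y') }
  have hlt : Module.finrank ℂ J < n := by
    rw [← hn]
    refine Submodule.finrank_lt (s := LinearMap.ker ξ) fun h => hξ0 ?_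
    exact LinearMap.ker_eq_top.1 h
  have h1 : jointSpectrum (ρ.comp J.incl)
      = (fun f => f ∘ₗ (J.incl : J →ₗ[ℂ] L)) '' jointSpectrum ρ := by
    refine jointSpectrum_comp_of_hyperplane ρ J.incl_injective (fun x y => ?_) ξ hξ0 fun y => ?_
    · exact ⟨⟨⁅x, (y : L)⁆, hξ x y⟩, rfl⟩
    · exact ⟨fun h => ⟨⟨y, h⟩, rfl⟩, by rintro ⟨y', rfl⟩; exact y'.2⟩
  have h2 := ih _ hlt (ρ.comp J.incl) ψ (fun y y' h => hφ (congrArg Subtype.val h))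
    (fun x y => by
      obtain ⟨y', hy'⟩ := hI x y
      exact ⟨y', Subtype.ext hy'⟩) rfl
  rw [h1, Set.image_image] at h2
  exact h2

end LieKoszul

theorem theorem4 {L E : Type*} [LieRing L] [LieAlgebra ℂ L] [FiniteDimensional ℂ L]
    [LieAlgebra.IsSolvable L] [NormedAddCommGroup E] [NormedSpace ℂ E] [CompleteSpace E]
    (ρ : L →ₗ⁅ℂ⁆ (E →L[ℂ] E)ᵐᵒᵖ) (I : LieIdeal ℂ L) :
    LieKoszul.jointSpectrum (ρ.comp I.incl) =
      (fun f : Module.Dual ℂ L => f ∘ₗ (I.incl : I →ₗ[ℂ] L)) '' LieKoszul.jointSpectrum ρ :=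
  LieKoszul.jointSpectrum_comp ρ I.incl I.incl_injective fun x y =>
    ⟨⟨⁅x, (y : L)⁆, I.lie_mem y.2⟩, rfl⟩
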